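/- **Setting.** Write $[r]=\{1,\dots,r\}$. An $[[n,k]]$ *self-dual CSS code* is the stabilizer code on $n$ qubits whose stabilizer group is $\{X^{g}Z^{h} : g,h\in C\}$, where $C\subseteq\mathbb F_2^n$ is a self-orthogonal subspace of dimension $(n-k)/2$. A *symplectic basis* of it is a family of pairs $(\bar X_j,\bar Z_j)_{j\in[k]}$ of Hermitian Pauli operators that commute with all stabilizers, with $\bar X_j\bar Z_j=-\bar Z_j\bar X_j$ and all other pairs commuting, and that together with the stabilizers and $iI$ generate the centralizer of the stabilizer group in the Pauli group. It determines, up to a global phase, an isometry $E$ from $(\mathbb C^2)^{\otimes k}$ onto the code space with $EX_j=\bar X_jE$ and $EZ_j=\bar Z_jE$. A physical operator $V$ *implements* a logical operator $U$ if $VE=c\,EU$ for some $|c|=1$. The basis is *compatible* if $H^{\otimes n}$ implements $H^{\otimes k}$ and if for every $a\in\{1,-1\}^k$ there is $b\in\{1,-1\}^n$ such that $\bigotimes_{i} S^{b_i}$ implements $\bigotimes_{j} S^{a_j}$. For $c\in[L]$ let $\mathcal Q_c$ be an $[[n_c,k_c]]$ self-dual CSS code with $k_c\ge 1$, equipped with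 a compatible symplectic basis. In the concatenated code $\mathcal Q_L\circ\cdots\circ\mathcal Q_1$ the logical qubits at level $l\in\{0,\dots,L\}$ are labelled by $[k_1]\times\cdots\times[k_l]\times[n_{l+1}]\times\cdots\times[n_L]$; for all fixed $j_1,\dots,j_{l-1},i_{l+1},\dots,i_L$, the code $\mathcal Q_l$ encodes the qubits $(j_1,\dots,j_{l-1},j,i_{l+1},\dots,i_L)$, $j\in[k_l]$, at level $l$ into the qubits $(j_1,\dots,j_{l-1},i,i_{l+1},\dots,i_L)$, $i\in[n_l]$, at level $l-1$. For $t\le l$ let $E_{t,l}$ be the resulting encoding of the states of the level-$l$ qubits into states of the level-$t$ qubits (with $E_{l,l}=I$). A gate $U$ on the level-$l$ qubits of one block of the concatenated code is *transversal at level $t$* if there are single-qubit unitaries $G_q$, one for each level-$t$ qubit $q$, with $(\bigotimes_q G_q)E_{t,l}=E_{t,l}U$. A gate $V$ on the level-$l$ qubits of two blocks is *transversal at level $t$* if there are two-qubit unitaries $F_q$, with $F_q$ acting on the level-$t$ qubits labelled $q$ of the first and of the second block, such that $(\bigotimes_q F_q)(E_{t,l}\otimes E_{t,l})=(E_{t,l}\otimes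 E_{t,l})V$. **Theorem.** Let $0\le m<l\le L$, let $j_1\in[k_1],\dots,j_m\in[k_m]$, $i_{l+1}\in[n_{l+1}],\dots,i_L\in[n_L]$, and put $$A=\{j_1\}\times\cdots\times\{j_m\}\times[k_{m+1}]\times\cdots\times[k_l]\times\{i_{l+1}\}\times\cdots\times\{i_L\}.$$ Then the following gates at level $l$ are transversal at each of the levels $m,m+1,\dots,l$: 1. the gate on one block that applies $H$ to each level-$l$ qubit in $A$ and the identity to the others; 2. for every $a\in\{1,-1\}^{A}$, the gate on one block that applies $S^{a_q}$ to each level-$l$ qubit $q\in A$ and the identity to the others; 3. the gate on two blocks that, for each $q\in A$, applies a CNOT gate with the level-$l$ qubit $q$ of the first block as control and the level-$l$ qubit $q$ of the second block as target, and the identity to the others. -/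

import Mathlib

open Matrix

namespace Multilevel

noncomputable section

/-! ### Qubits, product gates and Pauli operators

A register of qubits labelled by `ι` has the state space `(ι → Fin 2) → ℂ`; an operator is a
matrix in the computational basis. -/

/-- Operators on a register of qubits labelled by `ι`. -/
abbrev Op (ι : Type) : Type := Matrix (ι → Fin 2) (ι → Fin 2) ℂ

/-- `⨂ i, G i`: the single-qubit operator `G i` acts on qubit `i`. -/
def tensor {ι : Type} [Fintype ι] (G : ι → Matrix (Fin 2) (Fin 2) ℂ) : Op ι :=
  Matrix.of fun x y => ∏ i, G i (x i) (y i)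

/-- Operators on two registers, both labelled by `ι`. -/
abbrev Op₂ (ι : Type) : Type :=
  Matrix ((ι → Fin 2) × (ι → Fin 2)) ((ι → Fin 2) × (ι → Fin 2)) ℂ

/-- `⨂ i, F i`: the two-qubit operator `F i` acts on qubit `i` of the first register and qubit `i`
of the second register. -/
def tensor₂ {ι : Type} [Fintype ι] (F : ι → Matrix (Fin 2 × Fin 2) (Fin 2 × Fin 2) ℂ) : Op₂ ι :=
  Matrix.of fun x y => ∏ i, F i (x.1 i, x.2 i) (y.1 i, y.2 i)

def sigmaX : Matrix (Fin 2) (Fin 2) ℂ := !![0, 1; 1, 0]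

def sigmaZ : Matrix (Fin 2) (Fin 2) ℂ := !![1, 0; 0, -1]

/-- The Hadamard gate. -/
def hadamard : Matrix (Fin 2) (Fin 2) ℂ := ((Real.sqrt 2 : ℝ) : ℂ)⁻¹ • !![1, 1; 1, -1]

/-- The phase gate `S`. -/
def phaseS : Matrix (Fin 2) (Fin 2) ℂ := !![1, 0; 0, Complex.I]

/-- `S ^ a` for `a ∈ {1, -1}`, where `S ^ (-1)` is the adjoint of `S`. -/
def phasePow (a : ℤˣ) : Matrix (Fin 2) (Fin 2) ℂ := if a = 1 then phaseS else phaseSᴴ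

/-- The CNOT gate `|c, t⟩ ↦ |c, c + t⟩`; the first qubit is the control. -/
def cnot : Matrix (Fin 2 × Fin 2) (Fin 2 × Fin 2) ℂ :=
  Matrix.of fun x y => if x = (y.1, y.1 + y.2) then 1 else 0

section Pauli

variable {ι : Type} [Fintype ι]

/-- The `X`-type Pauli operator acting as `X` on the qubits `i` with `x i = 1`. -/
def pauliX (x : ι → ZMod 2) : Op ι := tensor fun i => if x i = 1 then sigmaX else 1

/-- The `Z`-type Pauli operator acting as `Z` on the qubits `i` with `z i = 1`. -/
def pauliZ (z : ι → ZMod 2) : Op ι := tensor fun i => if z i = 1 then sigmaZ else 1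

/-- Membership in the Pauli group (with phases `1, i, -1, -i`). -/
def IsPauli [DecidableEq ι] (P : Op ι) : Prop :=
  ∃ (c : ℕ) (x z : ι → ZMod 2), P = Complex.I ^ c • (pauliX x * pauliZ z)

end Pauli

/-! ### Self-dual CSS codes -/

/-- A self-dual CSS code with `n` physical and `k` logical qubits. `checks` is the row space of the
common check matrix of the `X`-type and the `Z`-type stabilizer generators, that is, the dual of a
classical code that contains its dual. It has dimension `(n - k) / 2`. -/
structure SelfDualCSS (n k : ℕ) where
  checks : Submodule (ZMod 2) (Fin n → ZMod 2)
  orthogonal : ∀ g ∈ checks, ∀ h ∈ checks, g ⬝ᵥ h = 0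
  finrank_checks : 2 * Module.finrank (ZMod 2) checks + k = n

section SingleCode

variable {n k : ℕ}

/-- The stabilizer group. -/
def SelfDualCSS.stabilizers (Q : SelfDualCSS n k) : Set (Op (Fin n)) :=
  {s | ∃ g ∈ Q.checks, ∃ h ∈ Q.checks, s = pauliX g * pauliZ h}

/-- The code space: the simultaneous `+1` eigenspace of the stabilizers. -/
def SelfDualCSS.codeSpace (Q : SelfDualCSS n k) : Submodule ℂ ((Fin n → Fin 2) → ℂ) where
  carrier := {ψ | ∀ s ∈ Q.stabilizers, s *ᵥ ψ = ψ}
  add_mem' {a b} ha hb s hs := by rw [Matrix.mulVec_add, ha s hs, hb s hs]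
  zero_mem' s _ := Matrix.mulVec_zero s
  smul_mem' c a ha s hs := by rw [Matrix.mulVec_smul, ha s hs]

/-- A symplectic basis: `k` hyperbolic pairs `(X j, Z j)` of (Hermitian) Pauli operators, not
necessarily of pure `X`- or `Z`-type, which together with the stabilizers and `i` generate the
centralizer of the stabilizer group in the Pauli group. -/
structure SymplecticBasis (Q : SelfDualCSS n k) where
  X : Fin k → Op (Fin n)
  Z : Fin k → Op (Fin n)
  isPauli_X : ∀ j, IsPauli (X j)
  isPauli_Z : ∀ j, IsPauli (Z j)
  isHermitian_X : ∀ j, (X j).IsHermitian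
  isHermitian_Z : ∀ j, (Z j).IsHermitian
  commute_X_stabilizer : ∀ j, ∀ s ∈ Q.stabilizers, Commute (X j) s
  commute_Z_stabilizer : ∀ j, ∀ s ∈ Q.stabilizers, Commute (Z j) s
  anticommute : ∀ j, X j * Z j = -(Z j * X j)
  commute_XZ : ∀ j j', j ≠ j' → Commute (X j) (Z j')
  commute_XX : ∀ j j', Commute (X j) (X j')
  commute_ZZ : ∀ j j', Commute (Z j) (Z j')
  generate : ∀ P, IsPauli P → (∀ s ∈ Q.stabilizers, Commute P s) →
    P ∈ Submonoid.closure
      (Q.stabilizers ∪ {Complex.I • (1 : Op (Fin n))} ∪ Set.range X ∪ Set.range Z)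

/-- `E` is an encoding map for the symplectic basis `B`: an isometry from the states of `k` logical
qubits onto the code space which turns the Pauli operators of the `j`-th qubit into the logical
Pauli operators `B.X j` and `B.Z j`. The column of `E` at `a` is the logical basis state labelled
by `a`. Such a map exists (`exists_encoder`) and is unique up to a global phase. -/
structure IsEncoder {Q : SelfDualCSS n k} (B : SymplecticBasis Q)
    (E : Matrix (Fin n → Fin 2) (Fin k → Fin 2) ℂ) : Prop where
  isometry : Eᴴ * E = 1
  range_eq : LinearMap.range E.mulVecLin = Q.codeSpace
  map_X : ∀ j, E * pauliX (Pi.single j 1) = B.X j * E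
  map_Z : ∀ j, E * pauliZ (Pi.single j 1) = B.Z j * E

/-! #### Existence of the encoding map -/

theorem tensor_mul {ι : Type} [Fintype ι] [DecidableEq ι] (G H : ι → Matrix (Fin 2) (Fin 2) ℂ) :
    tensor G * tensor H = tensor fun i => G i * H i := by
  ext x y
  simp only [tensor, Matrix.mul_apply, Matrix.of_apply, ← Finset.prod_mul_distrib]
  rw [Finset.prod_univ_sum, Fintype.piFinset_univ]

theorem tensor_one {ι : Type} [Fintype ι] [DecidableEq ι] :
    tensor (fun _ : ι => (1 : Matrix (Fin 2) (Fin 2) ℂ)) = 1 := by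
  ext x y
  simp only [tensor, Matrix.of_apply, Matrix.one_apply, funext_iff]
  by_cases h : ∀ i, x i = y i
  · simp [h]
  · rw [if_neg h]
    obtain ⟨i, hi⟩ := not_forall.mp h
    exact Finset.prod_eq_zero (Finset.mem_univ i) (if_neg hi)

theorem trace_tensor {ι : Type} [Fintype ι] [DecidableEq ι] (G : ι → Matrix (Fin 2) (Fin 2) ℂ) :
    (tensor G).trace = ∏ i, (G i).trace := by
  simp only [tensor, Matrix.trace, Matrix.diag, Matrix.of_apply]
  rw [Finset.prod_univ_sum, Fintype.piFinset_univ]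

theorem conjTranspose_tensor {ι : Type} [Fintype ι] (G : ι → Matrix (Fin 2) (Fin 2) ℂ) :
    (tensor G)ᴴ = tensor fun i => (G i)ᴴ := by
  ext x y
  simp [tensor, Matrix.conjTranspose_apply]

theorem zmod_two_cases (a : ZMod 2) : a = 0 ∨ a = 1 := by
  revert a; decide

theorem sigmaX_mul_self : sigmaX * sigmaX = 1 := by
  ext i j; fin_cases i <;> fin_cases j <;> simp [sigmaX]

theorem sigmaZ_mul_self : sigmaZ * sigmaZ = 1 := by
  ext i j; fin_cases i <;> fin_cases j <;> simp [sigmaZ]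

theorem sigmaZ_mul_sigmaX : sigmaZ * sigmaX = (-1 : ℂ) • (sigmaX * sigmaZ) := by
  ext i j; fin_cases i <;> fin_cases j <;> simp [sigmaX, sigmaZ]

theorem tensor_smul {ι : Type} [Fintype ι] (r : ι → ℂ) (G : ι → Matrix (Fin 2) (Fin 2) ℂ) :
    tensor (fun i => r i • G i) = (∏ i, r i) • tensor G := by
  ext x y
  simp [tensor, Finset.prod_mul_distrib]

theorem conjTranspose_pauliX {ι : Type} [Fintype ι] (x : ι → ZMod 2) :
    (pauliX x)ᴴ = pauliX x := by
  rw [pauliX, conjTranspose_tensor]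
  congr 1; funext i
  split_ifs
  · ext a b; fin_cases a <;> fin_cases b <;> simp [sigmaX]
  · simp

theorem conjTranspose_pauliZ {ι : Type} [Fintype ι] (x : ι → ZMod 2) :
    (pauliZ x)ᴴ = pauliZ x := by
  rw [pauliZ, conjTranspose_tensor]
  congr 1; funext i
  split_ifs
  · ext a b; fin_cases a <;> fin_cases b <;> simp [sigmaZ]
  · simp

section PauliLemmas

variable {ι : Type} [Fintype ι] [DecidableEq ι]

theorem pauliX_zero : pauliX (0 : ι → ZMod 2) = 1 := by
  simp [pauliX, tensor_one]

theorem pauliZ_zero : pauliZ (0 : ι → ZMod 2) = 1 := by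
  simp [pauliZ, tensor_one]

theorem pauliX_add (x y : ι → ZMod 2) : pauliX (x + y) = pauliX x * pauliX y := by
  rw [pauliX, pauliX, pauliX, tensor_mul]
  congr 1; funext i
  rcases zmod_two_cases (x i) with h | h <;> rcases zmod_two_cases (y i) with h2 | h2 <;>
    simp [h, h2, sigmaX_mul_self, CharTwo.add_self_eq_zero]

theorem pauliZ_add (x y : ι → ZMod 2) : pauliZ (x + y) = pauliZ x * pauliZ y := by
  rw [pauliZ, pauliZ, pauliZ, tensor_mul]
  congr 1; funext i
  rcases zmod_two_cases (x i) with h | h <;> rcases zmod_two_cases (y i) with h2 | h2 <;>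
    simp [h, h2, sigmaZ_mul_self, CharTwo.add_self_eq_zero]

/-- The sign `(-1) ^ a`. -/
def sgn (a : ZMod 2) : ℂ := if a = 1 then -1 else 1

theorem sgn_add (a b : ZMod 2) : sgn (a + b) = sgn a * sgn b := by
  rcases zmod_two_cases a with h | h <;> rcases zmod_two_cases b with h2 | h2 <;>
    simp [h, h2, sgn, CharTwo.add_self_eq_zero]

theorem sgn_sum (f : ι → ZMod 2) : sgn (∑ i, f i) = ∏ i, sgn (f i) := by
  have : ∀ s : Finset ι, sgn (∑ i ∈ s, f i) = ∏ i ∈ s, sgn (f i) := by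
    intro s
    induction s using Finset.induction_on with
    | empty => simp [sgn]
    | insert a s ha ih => rw [Finset.sum_insert ha, Finset.prod_insert ha, sgn_add, ih]
  exact this _

theorem pauliZ_mul_pauliX (z x : ι → ZMod 2) :
    pauliZ z * pauliX x = sgn (z ⬝ᵥ x) • (pauliX x * pauliZ z) := by
  rw [pauliX, pauliZ, tensor_mul, tensor_mul, dotProduct, sgn_sum, ← tensor_smul]
  congr 1; funext i
  rcases zmod_two_cases (x i) with h | h <;> rcases zmod_two_cases (z i) with h2 | h2 <;>
    simp [h, h2, sigmaZ_mul_sigmaX, sgn]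

theorem pauliX_mul_self (x : ι → ZMod 2) : pauliX x * pauliX x = 1 := by
  rw [← pauliX_add, ← pauliX_zero]; congr 1; funext i; exact CharTwo.add_self_eq_zero _

theorem pauliZ_mul_self (x : ι → ZMod 2) : pauliZ x * pauliZ x = 1 := by
  rw [← pauliZ_add, ← pauliZ_zero]; congr 1; funext i; exact CharTwo.add_self_eq_zero _

theorem IsPauli.mul_self {P : Op ι} (h : IsPauli P) (hP : P.IsHermitian) : P * P = 1 := by
  nth_rewrite 1 [← hP.eq]
  obtain ⟨c, x, z, rfl⟩ := h
  rw [conjTranspose_smul, conjTranspose_mul, conjTranspose_pauliX, conjTranspose_pauliZ,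
    smul_mul_smul_comm, mul_assoc, ← mul_assoc (pauliX x), pauliX_mul_self, one_mul,
    pauliZ_mul_self]
  have : star (Complex.I ^ c) * Complex.I ^ c = 1 := by
    rw [star_pow, ← mul_pow]; simp
  rw [this, one_smul]

theorem trace_pauli (x z : ι → ZMod 2) :
    (pauliX x * pauliZ z).trace = if x = 0 ∧ z = 0 then 2 ^ Fintype.card ι else 0 := by
  split_ifs with h
  · rw [h.1, h.2, pauliX_zero, pauliZ_zero, mul_one]
    simp [Matrix.trace_one]
  · rw [pauliX, pauliZ, tensor_mul, trace_tensor]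
    have : ∃ i, x i ≠ 0 ∨ z i ≠ 0 := by
      by_contra hc
      push Not at hc
      exact h ⟨funext fun i => (hc i).1, funext fun i => (hc i).2⟩
    obtain ⟨i, hi⟩ := this
    apply Finset.prod_eq_zero (Finset.mem_univ i)
    rcases zmod_two_cases (x i) with h | h <;> rcases zmod_two_cases (z i) with h2 | h2 <;>
      simp_all [sigmaX, sigmaZ, Matrix.trace_fin_two]

end PauliLemmas

open Classical in
/-- The code space has dimension `2 ^ k`. -/
theorem finrank_codeSpace (Q : SelfDualCSS n k) : Module.finrank ℂ Q.codeSpace = 2 ^ k := by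
  set N : ℂ := (Fintype.card Q.checks : ℂ) with hN
  have hN0 : N ≠ 0 := by rw [hN]; exact_mod_cast Fintype.card_ne_zero
  set T : Op (Fin n) := ∑ p : Q.checks × Q.checks, pauliX (p.1 : Fin n → ZMod 2) * pauliZ (p.2 : Fin n → ZMod 2) with hT
  have habs : ∀ s ∈ Q.stabilizers, s * T = T := by
    rintro s ⟨g, hg, h, hh, rfl⟩
    rw [hT, Finset.mul_sum]
    refine Fintype.sum_equiv (Equiv.addLeft ((⟨g, hg⟩, ⟨h, hh⟩) : Q.checks × Q.checks)) _ _ ?_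
    rintro ⟨⟨a, ha⟩, ⟨b, hb⟩⟩
    simp only [Equiv.coe_addLeft, Prod.mk_add_mk, AddMemClass.mk_add_mk]
    rw [pauliX_add, pauliZ_add, mul_assoc, ← mul_assoc (pauliZ h), pauliZ_mul_pauliX,
      Q.orthogonal h hh a ha]
    simp [sgn, mul_assoc]
  set P : Op (Fin n) := (N ^ 2)⁻¹ • T with hP
  have hproj : LinearMap.IsProj Q.codeSpace (Matrix.toLin' P) := by
    constructor
    · intro v s hs
      rw [Matrix.toLin'_apply, Matrix.mulVec_mulVec, hP, Matrix.mul_smul, habs s hs]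
    · intro v hv
      have : T *ᵥ v = (N ^ 2) • v := by
        rw [hT, Matrix.sum_mulVec, Finset.sum_congr rfl (g := fun _ => v)]
        · rw [Finset.sum_const, Finset.card_univ, Fintype.card_prod, ← Nat.cast_smul_eq_nsmul ℂ, hN]
          push_cast; rw [pow_two]
        · rintro ⟨⟨a, ha⟩, ⟨b, hb⟩⟩ -
          exact hv _ ⟨a, ha, b, hb, rfl⟩
      rw [Matrix.toLin'_apply, hP, Matrix.smul_mulVec, this, smul_smul, inv_mul_cancel₀ (by positivity), one_smul]
  have htr := hproj.trace
  rw [Matrix.trace_toLin'_eq, hP, Matrix.trace_smul, hT, Matrix.trace_sum] at htr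
  simp only [trace_pauli] at htr
  rw [Finset.sum_eq_single (0 : Q.checks × Q.checks)] at htr
  · have hcard : Fintype.card Q.checks = 2 ^ Module.finrank (ZMod 2) Q.checks := by
      rw [Module.card_eq_pow_finrank (K := ZMod 2), ZMod.card]
    have h2 : (2 : ℂ) ^ n = N ^ 2 * 2 ^ k := by
      rw [hN, hcard]; push_cast
      rw [← pow_mul, ← pow_add, mul_comm _ 2, Q.finrank_checks]
    simp only [Prod.fst_zero, Prod.snd_zero, ZeroMemClass.coe_zero, and_self, if_true,
      Fintype.card_fin, h2, smul_eq_mul] at htr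
    rw [← mul_assoc, inv_mul_cancel₀ (pow_ne_zero 2 hN0), one_mul] at htr
    exact_mod_cast htr.symm
  · rintro ⟨⟨a, ha⟩, ⟨b, hb⟩⟩ - h
    apply if_neg
    rintro ⟨h1, h2⟩
    apply h
    simp only at h1 h2
    subst h1; subst h2; rfl
  · simp

/-- There is a nonzero encoded state fixed by all the `Z j`. -/
theorem exists_logical_zero {Q : SelfDualCSS n k} (B : SymplecticBasis Q) :
    ∃ ψ ∈ Q.codeSpace, ψ ≠ 0 ∧ ∀ j, B.Z j *ᵥ ψ = ψ := by
  have hX := fun j => (B.isPauli_X j).mul_self (B.isHermitian_X j)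
  have hZ := fun j => (B.isPauli_Z j).mul_self (B.isHermitian_Z j)
  have key : ∀ T : Finset (Fin k), ∃ ψ ∈ Q.codeSpace, ψ ≠ 0 ∧ ∀ j ∈ T, B.Z j *ᵥ ψ = ψ := by
    intro T
    induction T using Finset.induction_on with
    | empty =>
      have : Q.codeSpace ≠ ⊥ := by
        intro h
        have h1 := finrank_codeSpace Q
        rw [h, finrank_bot] at h1
        exact (pow_ne_zero k two_ne_zero) h1.symm
      obtain ⟨ψ, h1, h2⟩ := Submodule.exists_mem_ne_zero_of_ne_bot this
      exact ⟨ψ, h1, h2, by simp⟩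
    | insert j T hj ih =>
      obtain ⟨ψ, h1, h2, h3⟩ := ih
      by_cases h : ψ + B.Z j *ᵥ ψ = 0
      · have h4 : B.Z j *ᵥ ψ = -ψ := by rw [eq_neg_iff_add_eq_zero, add_comm]; exact h
        refine ⟨B.X j *ᵥ ψ, ?_, ?_, ?_⟩
        · intro s hs
          rw [Matrix.mulVec_mulVec, ← (B.commute_X_stabilizer j s hs).eq, ← Matrix.mulVec_mulVec,
            h1 s hs]
        · intro h0
          apply h2
          rw [← Matrix.one_mulVec ψ, ← hX j, ← Matrix.mulVec_mulVec, h0, Matrix.mulVec_zero]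
        · intro i hi
          rcases Finset.mem_insert.mp hi with rfl | hi
          · rw [Matrix.mulVec_mulVec, ← neg_eq_iff_eq_neg.mpr (B.anticommute i), Matrix.neg_mulVec,
              ← Matrix.mulVec_mulVec, h4, Matrix.mulVec_neg, neg_neg]
          · have hne : j ≠ i := by rintro rfl; exact hj hi
            rw [Matrix.mulVec_mulVec, ← (B.commute_XZ j i hne).eq, ← Matrix.mulVec_mulVec, h3 i hi]
      · refine ⟨ψ + B.Z j *ᵥ ψ, ?_, h, ?_⟩
        · intro s hs
          rw [Matrix.mulVec_add, Matrix.mulVec_mulVec, ← (B.commute_Z_stabilizer j s hs).eq,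
            ← Matrix.mulVec_mulVec, h1 s hs]
        · intro i hi
          rcases Finset.mem_insert.mp hi with rfl | hi
          · rw [Matrix.mulVec_add, Matrix.mulVec_mulVec, hZ, Matrix.one_mulVec, add_comm]
          · rw [Matrix.mulVec_add, Matrix.mulVec_mulVec, (B.commute_ZZ i j).eq,
              ← Matrix.mulVec_mulVec, h3 i hi]
  obtain ⟨ψ, h1, h2, h3⟩ := key Finset.univ
  exact ⟨ψ, h1, h2, fun j => h3 j (Finset.mem_univ j)⟩

/-- Basis labels of a register as binary vectors. -/
def bits {ι : Type} : (ι → Fin 2) ≃ (ι → ZMod 2) := Equiv.refl _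

theorem pauliX_apply {ι : Type} [Fintype ι] [DecidableEq ι] (x : ι → ZMod 2) (y b : ι → Fin 2) :
    pauliX x y b = if bits y = bits b + x then 1 else 0 := by
  have hs : ∀ i, (if x i = 1 then sigmaX else 1) (y i) (b i) =
      if bits y i = bits b i + x i then (1 : ℂ) else 0 := by
    intro i
    have key : ∀ (u : ZMod 2) (v w : Fin 2), ((show ZMod 2 from v) = (show ZMod 2 from w) + u) ↔
        ((u = 0 ∧ v = w) ∨ (u = 1 ∧ v ≠ w)) := by decide
    have key2 : bits y i = bits b i + x i ↔ ((x i = 0 ∧ y i = b i) ∨ (x i = 1 ∧ y i ≠ b i)) :=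
      key (x i) (y i) (b i)
    rw [if_congr key2 rfl rfl]
    generalize x i = u
    generalize y i = v
    generalize b i = w
    rcases zmod_two_cases u with rfl | rfl <;> fin_cases v <;> fin_cases w <;> simp [sigmaX]
  simp only [pauliX, tensor, Matrix.of_apply, hs]
  by_cases h : bits y = bits b + x
  · rw [if_pos h]
    exact Finset.prod_eq_one fun i _ => if_pos (congrFun h i)
  · rw [if_neg h]
    obtain ⟨i, hi⟩ := Function.ne_iff.mp h
    exact Finset.prod_eq_zero (Finset.mem_univ i) (if_neg hi)

theorem pauliZ_single_apply {ι : Type} [Fintype ι] [DecidableEq ι] (j : ι) :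
    pauliZ (Pi.single j 1 : ι → ZMod 2) = Matrix.diagonal fun y => sgn (bits y j) := by
  have : pauliZ (Pi.single j 1 : ι → ZMod 2) = tensor fun i => Matrix.diagonal fun v : Fin 2 =>
      if i = j then (if v = 1 then -1 else 1) else 1 := by
    rw [pauliZ]; congr 1; funext i
    by_cases h : i = j
    · subst h
      ext a b; fin_cases a <;> fin_cases b <;> simp [sigmaZ]
    · simp [h]
  rw [this]
  ext y b
  simp only [tensor, Matrix.of_apply, Matrix.diagonal_apply]
  by_cases h : y = b
  · subst h; simp; rfl
  · rw [if_neg h]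
    obtain ⟨i, hi⟩ := Function.ne_iff.mp h
    exact Finset.prod_eq_zero (Finset.mem_univ i) (if_neg hi)

theorem exists_logical_X {Q : SelfDualCSS n k} (B : SymplecticBasis Q) :
    ∃ f : (Fin k → ZMod 2) → Op (Fin n), f 0 = 1 ∧ (∀ a b, f (a + b) = f a * f b) ∧
      ∀ j, f (Pi.single j 1) = B.X j := by
  have hX := fun j => (B.isPauli_X j).mul_self (B.isHermitian_X j)
  let ϕ : Fin k → (Multiplicative (ZMod 2) →* Op (Fin n)) := fun j =>
    { toFun := fun a => if a.toAdd = 1 then B.X j else 1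
      map_one' := by simp
      map_mul' := by
        intro a b
        rcases zmod_two_cases a.toAdd with h | h <;> rcases zmod_two_cases b.toAdd with h2 | h2 <;>
          simp [h, h2, hX, CharTwo.add_self_eq_zero] }
  have hc : Pairwise fun i j => ∀ (x y : Multiplicative (ZMod 2)), Commute (ϕ i x) (ϕ j y) := by
    intro i j _ x y
    simp only [ϕ, MonoidHom.coe_mk, OneHom.coe_mk]
    split_ifs <;> simp [B.commute_XX]
  refine ⟨fun a => MonoidHom.noncommPiCoprod ϕ hc fun j => Multiplicative.ofAdd (a j), ?_, ?_, ?_⟩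
  · exact map_one (MonoidHom.noncommPiCoprod ϕ hc)
  · intro a b
    rw [← map_mul]; rfl
  · intro j
    have : (fun i => Multiplicative.ofAdd ((Pi.single j 1 : Fin k → ZMod 2) i)) =
        Pi.mulSingle j (Multiplicative.ofAdd (1 : ZMod 2)) := by
      funext i
      by_cases h : i = j
      · subst h; simp
      · simp [h]
    beta_reduce
    rw [this, MonoidHom.noncommPiCoprod_mulSingle]
    simp [ϕ]

open scoped ComplexOrder in
theorem exists_encoder {Q : SelfDualCSS n k} (B : SymplecticBasis Q) : ∃ E, IsEncoder B E := by
  have hZ := fun j => (B.isPauli_Z j).mul_self (B.isHermitian_Z j)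
  obtain ⟨ψ₀, hψ₀, hne, hψZ₀⟩ := exists_logical_zero B
  obtain ⟨ψ, hψ, hψZ, hnorm⟩ : ∃ ψ ∈ Q.codeSpace, (∀ j, B.Z j *ᵥ ψ = ψ) ∧ star ψ ⬝ᵥ ψ = 1 := by
    have hpos : 0 < star ψ₀ ⬝ᵥ ψ₀ := dotProduct_star_self_pos_iff.mpr hne
    obtain ⟨r, hr, hr2⟩ : ∃ r : ℝ, 0 < r ∧ star ψ₀ ⬝ᵥ ψ₀ = r := by
      have := Complex.pos_iff.mp hpos
      exact ⟨_, this.1, Complex.ext rfl this.2.symm⟩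
    refine ⟨((Real.sqrt r : ℝ) : ℂ)⁻¹ • ψ₀, Q.codeSpace.smul_mem _ hψ₀, ?_, ?_⟩
    · intro j; rw [Matrix.mulVec_smul, hψZ₀]
    · rw [star_smul, smul_dotProduct, dotProduct_smul, hr2, ← Complex.ofReal_inv]
      simp only [Complex.star_def, Complex.conj_ofReal, smul_eq_mul]
      norm_cast
      have := Real.mul_self_sqrt hr.le
      have h0 : Real.sqrt r ≠ 0 := (Real.sqrt_pos.mpr hr).ne'
      field_simp
      rw [pow_two, this]
  obtain ⟨f, f0, fadd, fX⟩ := exists_logical_X B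
  have ind : ∀ p : (Fin k → ZMod 2) → Prop, p 0 → (∀ a b, p a → p b → p (a + b)) →
      (∀ j, p (Pi.single j 1)) → ∀ a, p a := by
    intro p p0 padd ps a
    rw [← Finset.univ_sum_single a]
    refine Finset.sum_induction _ p padd p0 fun i _ => ?_
    rcases zmod_two_cases (a i) with h | h
    · rw [h, Pi.single_zero]; exact p0
    · rw [h]; exact ps i
  have fherm : ∀ a, (f a)ᴴ = f a := by
    refine ind _ (by rw [f0]; simp) ?_ ?_
    · intro a b ha hb
      rw [fadd, conjTranspose_mul, ha, hb, ← fadd, ← fadd, add_comm]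
    · intro j; rw [fX]; exact B.isHermitian_X j
  have fstab : ∀ a, ∀ s ∈ Q.stabilizers, Commute (f a) s := by
    refine ind _ (by rw [f0]; simp) ?_ ?_
    · intro a b ha hb s hs
      rw [fadd]; exact (ha s hs).mul_left (hb s hs)
    · intro j; rw [fX]; exact B.commute_X_stabilizer j
  have fZ : ∀ j a, B.Z j * f a = sgn (a j) • (f a * B.Z j) := by
    intro j
    refine ind _ (by rw [f0]; simp [sgn]) ?_ ?_
    · intro a b ha hb
      rw [fadd, ← mul_assoc, ha, Matrix.smul_mul, mul_assoc, hb, Matrix.mul_smul, smul_smul,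
        Pi.add_apply, sgn_add, mul_assoc]
    · intro i
      rw [fX]
      by_cases h : i = j
      · subst h; simp [sgn, B.anticommute]
      · rw [← (B.commute_XZ i j h).eq]; simp [sgn, Ne.symm h]
  have fself : ∀ a, f a * f a = 1 := by
    intro a
    rw [← fadd, ← f0]; congr 1; funext i; exact CharTwo.add_self_eq_zero _
  have forth : ∀ a : Fin k → ZMod 2, a ≠ 0 → star ψ ⬝ᵥ (f a *ᵥ ψ) = 0 := by
    intro a ha
    obtain ⟨j, hj⟩ := Function.ne_iff.mp ha
    have hj1 : a j = 1 := (zmod_two_cases (a j)).resolve_left hj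
    have h1 : star ψ ⬝ᵥ (f a *ᵥ ψ) = star ψ ⬝ᵥ (B.Z j *ᵥ (f a *ᵥ ψ)) := by
      have : star ψ = star ψ ᵥ* B.Z j := by
        conv_lhs => rw [← hψZ j, Matrix.star_mulVec, (B.isHermitian_Z j).eq]
      conv_lhs => rw [this]
      rw [Matrix.dotProduct_mulVec (star ψ) (B.Z j)]
    rw [Matrix.mulVec_mulVec, fZ, hj1, Matrix.smul_mulVec, ← Matrix.mulVec_mulVec, hψZ] at h1
    simp only [sgn, if_true, neg_smul, one_smul, dotProduct_neg] at h1
    exact self_eq_neg.mp h1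
  let E : Matrix (Fin n → Fin 2) (Fin k → Fin 2) ℂ := Matrix.of fun x a => (f (bits a) *ᵥ ψ) x
  have hiso : Eᴴ * E = 1 := by
    ext a b
    have h1 : (Eᴴ * E) a b = star (f (bits a) *ᵥ ψ) ⬝ᵥ (f (bits b) *ᵥ ψ) := rfl
    have h2 : star (f (bits a) *ᵥ ψ) ⬝ᵥ (f (bits b) *ᵥ ψ) = star ψ ⬝ᵥ (f (bits a + bits b) *ᵥ ψ) := by
      rw [Matrix.star_mulVec, fherm, ← Matrix.dotProduct_mulVec, Matrix.mulVec_mulVec, fadd]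
    rw [h1, h2, Matrix.one_apply]
    split_ifs with h
    · subst h
      rw [fadd, fself, Matrix.one_mulVec, hnorm]
    · apply forth
      intro h0
      apply h
      apply bits.injective
      funext i
      exact CharTwo.add_eq_zero.mp (congrFun h0 i)
  refine ⟨E, hiso, ?_, ?_, ?_⟩
  · apply Submodule.eq_of_le_of_finrank_eq
    · rintro _ ⟨φ, rfl⟩ s hs
      have : s * E = E := by
        ext x a
        have h1 : (s * E) x a = (s *ᵥ (f (bits a) *ᵥ ψ)) x := rfl
        rw [h1, Matrix.mulVec_mulVec, ← (fstab (bits a) s hs).eq, ← Matrix.mulVec_mulVec, hψ s hs]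
        rfl
      rw [Matrix.mulVecLin_apply, Matrix.mulVec_mulVec, this]
    · rw [finrank_codeSpace, LinearMap.finrank_range_of_inj]
      · simp
      · intro u v huv
        have h1 := congrArg (fun w => Eᴴ *ᵥ w) huv
        simpa [Matrix.mulVec_mulVec, hiso] using h1
  · intro j
    ext x a
    have h1 : (B.X j * E) x a = (B.X j *ᵥ (f (bits a) *ᵥ ψ)) x := rfl
    rw [h1, Matrix.mulVec_mulVec, ← fX, ← fadd, Matrix.mul_apply]
    rw [Finset.sum_eq_single (bits.symm (bits a + Pi.single j 1))]
    · rw [pauliX_apply, if_pos (by simp), mul_one, add_comm]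
      simp [E]
    · intro b _ hb
      rw [pauliX_apply, if_neg, mul_zero]
      intro h
      exact hb (by rw [← h]; simp)
    · simp
  · intro j
    ext x a
    have h1 : (B.Z j * E) x a = (B.Z j *ᵥ (f (bits a) *ᵥ ψ)) x := rfl
    rw [h1, Matrix.mulVec_mulVec, fZ, Matrix.smul_mulVec, ← Matrix.mulVec_mulVec, hψZ,
      pauliZ_single_apply, Matrix.mul_diagonal, Pi.smul_apply, smul_eq_mul, mul_comm]
    rfl

/-- The encoding map of a symplectic basis (unique up to a global phase, which plays no role
below). -/
def SymplecticBasis.encoder {Q : SelfDualCSS n k} (B : SymplecticBasis Q) :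
    Matrix (Fin n → Fin 2) (Fin k → Fin 2) ℂ :=
  Classical.choose (exists_encoder B)

theorem SymplecticBasis.isEncoder {Q : SelfDualCSS n k} (B : SymplecticBasis Q) :
    IsEncoder B B.encoder :=
  Classical.choose_spec (exists_encoder B)

/-- The physical operator `V` on one code block implements the logical operator `U`, up to a global
phase. -/
def SymplecticBasis.Implements {Q : SelfDualCSS n k} (B : SymplecticBasis Q)
    (V : Op (Fin n)) (U : Op (Fin k)) : Prop :=
  ∃ c : ℂ, ‖c‖ = 1 ∧ V * B.encoder = c • (B.encoder * U)

/-- Compatibility with multilevel transversal Clifford operations: the logical Hadamard gate on all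
logical qubits is the transversal physical Hadamard gate, and each choice of logical `S` or `S†` on
all the logical qubits is given by some choice of physical `S` or `S†` on all the physical
qubits. -/
structure SymplecticBasis.IsCompatible {Q : SelfDualCSS n k} (B : SymplecticBasis Q) : Prop where
  hadamard : B.Implements (tensor fun _ => hadamard) (tensor fun _ => hadamard)
  phase : ∀ a : Fin k → ℤˣ, ∃ b : Fin n → ℤˣ,
    B.Implements (tensor fun i => phasePow (b i)) (tensor fun j => phasePow (a j))

end SingleCode

/-! ### Concatenated codes

The `L` codes are numbered by `c : Fin L`, starting from the innermost one; code `c` encodes the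
logical qubits at level `c` into those at level `c + 1`. -/

section Concatenation

variable {L : ℕ}

/-- The range of the `c`-th index of a logical qubit at level `l`. -/
abbrev size (n k : Fin L → ℕ) (l : ℕ) (c : Fin L) : ℕ := if c.val < l then k c else n c

/-- Labels of the logical qubits at level `l`: the elements of
`[k_1] × ⋯ × [k_l] × [n_{l+1}] × ⋯ × [n_L]`. Level `0` consists of the physical qubits. -/
abbrev Idx (n k : Fin L → ℕ) (l : ℕ) : Type := ∀ c : Fin L, Fin (size n k l c)

/-- Labels of the blocks of code `c`: all indices other than the `c`-th one. -/
abbrev Block (n k : Fin L → ℕ) (c : Fin L) : Type :=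
  ∀ c' : {c' : Fin L // c' ≠ c}, Fin (size n k c.val c')

variable {n k : Fin L → ℕ}

/-- The label of the `i`-th of the `n c` qubits at level `c` which belong to the block `b`. -/
def Block.inner {c : Fin L} (b : Block n k c) (i : Fin (n c)) : Idx n k c.val :=
  fun c' => if h : c' = c then Fin.cast (by subst h; simp [size]) i else b ⟨c', h⟩

/-- The label of the `j`-th of the `k c` qubits at level `c + 1` which belong to the block `b`. -/
def Block.outer {c : Fin L} (b : Block n k c) (j : Fin (k c)) : Idx n k (c.val + 1) :=
  fun c' => if h : c' = c then Fin.cast (by subst h; simp [size]) j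
    else Fin.cast (by
      have h1 : c'.val ≠ c.val := fun e => h (Fin.ext e)
      have h2 : c'.val < c.val + 1 ↔ c'.val < c.val := by omega
      simp only [size, h2]) (b ⟨c', h⟩)

variable {Q : ∀ c, SelfDualCSS (n c) (k c)}

/-- The encoding of code `c`, applied to each of its blocks: it maps the states of the logical
qubits at level `c + 1` to states of those at level `c`. -/
def stepEncoder (B : ∀ c, SymplecticBasis (Q c)) (c : Fin L) :
    Matrix (Idx n k c.val → Fin 2) (Idx n k (c.val + 1) → Fin 2) ℂ :=
  Matrix.of fun x y =>
    ∏ b : Block n k c, (B c).encoder (fun i => x (b.inner i)) (fun j => y (b.outer j))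

/-- The encoding of the logical qubits at level `l` into those at level `m`, for `m ≤ l ≤ L`: the
composition of the encodings of the codes `m, …, l - 1`. -/
def levelEncoder (B : ∀ c, SymplecticBasis (Q c)) {m l : ℕ} (h : m ≤ l) :
    Matrix (Idx n k m → Fin 2) (Idx n k l → Fin 2) ℂ :=
  Nat.leRecOn (C := fun l => Matrix (Idx n k m → Fin 2) (Idx n k l → Fin 2) ℂ) h
    (fun {l} E => if hl : l < L then E * stepEncoder B ⟨l, hl⟩ else 0) 1

/-- The gate `U` on the logical qubits at level `l` of one block of the concatenated code is
transversal at level `m`: on the encoded states it is a product of single-qubit gates on the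
logical qubits at level `m`. -/
def IsTransversalAt (B : ∀ c, SymplecticBasis (Q c)) {m l : ℕ} (h : m ≤ l)
    (U : Op (Idx n k l)) : Prop :=
  ∃ G : Idx n k m → Matrix (Fin 2) (Fin 2) ℂ,
    (∀ q, G q ∈ Matrix.unitaryGroup (Fin 2) ℂ) ∧
    tensor G * levelEncoder B h = levelEncoder B h * U

/-- The gate `V` on the logical qubits at level `l` of two blocks of the concatenated code is
transversal at level `m`: on the encoded states it is a product of two-qubit gates, each acting on
the logical qubits at level `m` with the same label in the two blocks. -/
def IsTransversalAt₂ (B : ∀ c, SymplecticBasis (Q c)) {m l : ℕ} (h : m ≤ l)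
    (V : Op₂ (Idx n k l)) : Prop :=
  ∃ F : Idx n k m → Matrix (Fin 2 × Fin 2) (Fin 2 × Fin 2) ℂ,
    (∀ q, F q ∈ Matrix.unitaryGroup (Fin 2 × Fin 2) ℂ) ∧
    tensor₂ F * kroneckerMap (· * ·) (levelEncoder B h) (levelEncoder B h) =
      kroneckerMap (· * ·) (levelEncoder B h) (levelEncoder B h) * V

variable {l : ℕ}

open Classical in
/-- The Hadamard-type transversal gate at level `l`: Hadamard gates on the qubits in the product of
the sets `A c`. -/
def gateH (A : ∀ c, Set (Fin (size n k l c))) : Op (Idx n k l) :=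
  tensor fun q => if ∀ c, q c ∈ A c then hadamard else 1

open Classical in
/-- The phase-type transversal gate at level `l`: `S` or its adjoint, as specified by `a`, on each
qubit in the product of the sets `A c` (the other values of `a` are not used). -/
def gateS (A : ∀ c, Set (Fin (size n k l c))) (a : Idx n k l → ℤˣ) : Op (Idx n k l) :=
  tensor fun q => if ∀ c, q c ∈ A c then phasePow (a q) else 1

open Classical in
/-- The CNOT-type transversal gate at level `l`: CNOT gates from the first to the second block on
the pairs of qubits with the same label in the product of the sets `A c`. -/
def gateCNOT (A : ∀ c, Set (Fin (size n k l c))) : Op₂ (Idx n k l) :=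
  tensor₂ fun q => if ∀ c, q c ∈ A c then cnot else 1

/-- The sets `{j_1}, …, {j_m}, [k_{m+1}], …, [k_l], {i_{l+1}}, …, {i_L}`, where the fixed indices
are those of `q`. -/
def indexSets (m : ℕ) (q : Idx n k l) (c : Fin L) : Set (Fin (size n k l c)) :=
  if m ≤ c.val ∧ c.val < l then Set.univ else {q c}

end Concatenation

end

end Multilevel

/-!
Call a set `𝒮` of gates liftable through an encoding if every product of gates from `𝒮` is
implemented by a product of gates from `𝒮`. Liftability descends through the levels of a
concatenated code one at a time, block by block, and the gates outside `A` stay trivial because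
membership of a label in `A` does not depend on the indices that these levels change. Two blocks are
one block whose sites are pairs of qubits, so all three gates come down to liftability through a
single code.

Compatibility says precisely that `{H}` and `{S, S†}` are liftable. It also forces every logical `Z`
operator to be a power of `Z` up to stabilizers and phase, since its `X`-part is a check;
conjugating by `H` gives a logical `X` operator with the same support, up to sign. Hence the
transversal CNOT implements the logical one up to the logical Pauli operator `Z^f ⊗ X^e` given by
the signs `f` and `e` of the logical `X` and `Z` operators, and `{CNOT · (Z^a ⊗ X^b)}` is liftable
through two copies of the code.
-/

open scoped Kronecker

namespace Multilevel

noncomputable section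

theorem exists_sgn_eq {c : ℂ} (h : c * c = 1) : ∃ a, c = sgn a := by
  rcases mul_self_eq_one_iff.mp h with rfl | rfl
  · exact ⟨0, (if_neg zero_ne_one).symm⟩
  · exact ⟨1, (if_pos rfl).symm⟩

section Realizes

variable {α β γ : Type*} [Fintype α] [Fintype β]

/-- `V` implements `U` through the encoding `E`, up to a global phase: the relation of
`SymplecticBasis.Implements`, for an arbitrary matrix in place of the encoding map of a code. -/
def Realizes (E : Matrix α β ℂ) (V : Matrix α α ℂ) (U : Matrix β β ℂ) : Prop :=
  ∃ φ : ℂ, ‖φ‖ = 1 ∧ V * E = φ • (E * U)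

namespace Realizes

variable {E : Matrix α β ℂ} {V V' : Matrix α α ℂ} {U U' : Matrix β β ℂ}

theorem of_eq (h : V * E = E * U) : Realizes E V U :=
  ⟨1, norm_one, by rw [h, one_smul]⟩

theorem one (E : Matrix α β ℂ) [DecidableEq α] [DecidableEq β] : Realizes E 1 1 :=
  of_eq (by rw [Matrix.one_mul, Matrix.mul_one])

theorem mul (h : Realizes E V U) (h' : Realizes E V' U') : Realizes E (V * V') (U * U') := by
  obtain ⟨φ, hφ, h⟩ := h
  obtain ⟨φ', hφ', h'⟩ := h'
  refine ⟨φ' * φ, by rw [norm_mul, hφ, hφ', mul_one], ?_⟩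
  rw [Matrix.mul_assoc, h', Matrix.mul_smul, ← Matrix.mul_assoc, h, Matrix.smul_mul, smul_smul,
    Matrix.mul_assoc]

theorem smul_left_iff {r : ℂ} (hr : ‖r‖ = 1) : Realizes E (r • V) U ↔ Realizes E V U := by
  have hr0 : r ≠ 0 := ne_zero_of_norm_ne_zero (hr.trans_ne one_ne_zero)
  constructor <;> rintro ⟨φ, hφ, h⟩
  · refine ⟨r⁻¹ * φ, by rw [norm_mul, norm_inv, hr, hφ, inv_one, mul_one], ?_⟩
    rw [mul_smul, ← h, Matrix.smul_mul, smul_smul, inv_mul_cancel₀ hr0, one_smul]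
  · exact ⟨r * φ, by rw [norm_mul, hr, hφ, mul_one], by rw [Matrix.smul_mul, h, smul_smul]⟩

theorem smul_right_iff {r : ℂ} (hr : ‖r‖ = 1) : Realizes E V (r • U) ↔ Realizes E V U := by
  have hr0 : r ≠ 0 := ne_zero_of_norm_ne_zero (hr.trans_ne one_ne_zero)
  constructor <;> rintro ⟨φ, hφ, h⟩
  · exact ⟨φ * r, by rw [norm_mul, hr, hφ, mul_one], by rw [h, Matrix.mul_smul, smul_smul]⟩
  · refine ⟨φ * r⁻¹, by rw [norm_mul, norm_inv, hr, hφ, inv_one, mul_one], ?_⟩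
    rw [Matrix.mul_smul, smul_smul, mul_assoc, inv_mul_cancel₀ hr0, mul_one, h]

theorem of_mul_right [DecidableEq β] {W : Matrix β β ℂ} {P : Matrix α α ℂ}
    (hPV : Realizes E (P * V) (W * U)) (hV : Realizes E V U) (hU : U * U' = 1) :
    Realizes E P W := by
  obtain ⟨φ, hφ, hPV⟩ := hPV
  obtain ⟨ψ, hψ, hV⟩ := hV
  have hψ0 : ψ ≠ 0 := ne_zero_of_norm_ne_zero (hψ.trans_ne one_ne_zero)
  refine ⟨ψ⁻¹ * φ, by rw [norm_mul, norm_inv, hψ, hφ, inv_one, mul_one], ?_⟩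
  have h : ψ • (P * E * U) = φ • (E * W * U) := by
    rw [Matrix.mul_assoc, ← Matrix.mul_smul, ← hV, ← Matrix.mul_assoc, hPV, Matrix.mul_assoc]
  calc P * E = ψ⁻¹ • (ψ • (P * E * U)) * U' := by
        rw [smul_smul, inv_mul_cancel₀ hψ0, one_smul, Matrix.mul_assoc, hU, Matrix.mul_one]
    _ = (ψ⁻¹ * φ) • (E * W) := by
        rw [h, smul_smul, Matrix.smul_mul, Matrix.mul_assoc, hU, Matrix.mul_one]

theorem comp [Fintype γ] {F : Matrix β γ ℂ} {W : Matrix γ γ ℂ} (h : Realizes E V U)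
    (hF : Realizes F U W) : Realizes (E * F) V W := by
  obtain ⟨φ, hφ, h⟩ := h
  obtain ⟨ψ, hψ, hF⟩ := hF
  refine ⟨φ * ψ, by rw [norm_mul, hφ, hψ, mul_one], ?_⟩
  rw [← Matrix.mul_assoc, h, Matrix.smul_mul, Matrix.mul_assoc, hF, Matrix.mul_smul, smul_smul,
    Matrix.mul_assoc]

theorem submatrix {α' β' : Type*} [Fintype α'] [Fintype β'] (h : Realizes E V U) (e : α' ≃ α)
    (f : β' ≃ β) : Realizes (E.submatrix e f) (V.submatrix e e) (U.submatrix f f) := by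
  obtain ⟨φ, hφ, h⟩ := h
  refine ⟨φ, hφ, ?_⟩
  rw [submatrix_mul_equiv, submatrix_mul_equiv, h, submatrix_smul, Pi.smul_apply, Pi.smul_apply]

theorem kronecker [Fintype γ] {δ : Type*} [Fintype δ] {F : Matrix γ δ ℂ} {W : Matrix γ γ ℂ}
    {W' : Matrix δ δ ℂ} (h : Realizes E V U) (h' : Realizes F W W') :
    Realizes (E ⊗ₖ F) (V ⊗ₖ W) (U ⊗ₖ W') := by
  obtain ⟨φ, hφ, h⟩ := h
  obtain ⟨ψ, hψ, h'⟩ := h'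
  refine ⟨φ * ψ, by rw [norm_mul, hφ, hψ, mul_one], ?_⟩
  rw [← mul_kronecker_mul, ← mul_kronecker_mul, h, h', smul_kronecker, kronecker_smul, smul_smul]

theorem exists_mul_eq_sgn_smul [DecidableEq α] [DecidableEq β] (hE : E ≠ 0) (h : Realizes E V U)
    (hV : V * V = 1) (hU : U * U = 1) : ∃ s, V * E = sgn s • (E * U) := by
  obtain ⟨φ, -, h⟩ := h
  have hφφ : (φ * φ) • E = (1 : ℂ) • E := by
    calc (φ * φ) • E = φ • (φ • (E * U)) * U := by
          rw [smul_smul, Matrix.smul_mul, Matrix.mul_assoc, hU, Matrix.mul_one]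
      _ = (1 : ℂ) • E := by
          rw [← h, ← Matrix.mul_smul, Matrix.mul_assoc, Matrix.smul_mul, ← h, ← Matrix.mul_assoc,
            hV, Matrix.one_mul, one_smul]
  obtain ⟨s, rfl⟩ := exists_sgn_eq (smul_left_injective ℂ hE hφφ)
  exact ⟨s, h⟩

theorem commutator_eq [DecidableEq β] (hE : E ≠ 0) (h : Realizes E V U) (h' : Realizes E V' U')
    (hU : IsUnit U) (hU' : IsUnit U') {r s : ℂ} (hr : V * V' = r • (V' * V))
    (hs : U * U' = s • (U' * U)) : r = s := by
  obtain ⟨φ, hφ, h⟩ := h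
  obtain ⟨φ', hφ', h'⟩ := h'
  have hVV' : V * V' * E = (φ * φ') • (E * (U * U')) := by
    rw [Matrix.mul_assoc, h', Matrix.mul_smul, ← Matrix.mul_assoc, h, Matrix.smul_mul, smul_smul,
      Matrix.mul_assoc, mul_comm]
  have hV'V : V' * V * E = (φ * φ') • (E * (U' * U)) := by
    rw [Matrix.mul_assoc, h, Matrix.mul_smul, ← Matrix.mul_assoc, h', Matrix.smul_mul, smul_smul,
      Matrix.mul_assoc]
  have hne : V' * V * E ≠ 0 := by
    obtain ⟨W, hW⟩ := (hU'.mul hU).exists_right_inv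
    intro h0
    rw [hV'V, smul_eq_zero_iff_right (norm_ne_zero_iff.mp (by rw [norm_mul, hφ, hφ']; norm_num))]
      at h0
    rw [← Matrix.mul_one E, ← hW, ← Matrix.mul_assoc, h0, Matrix.zero_mul] at hE
    exact hE rfl
  refine smul_left_injective ℂ hne ?_
  calc r • (V' * V * E) = V * V' * E := by rw [hr, Matrix.smul_mul]
    _ = s • (V' * V * E) := by rw [hVV', hs, hV'V, Matrix.mul_smul, smul_comm]

end Realizes

end Realizes

section TensorPi

variable {ι κ β S T T' R : Type*} [Fintype ι] [Fintype κ] [Fintype β] [CommSemiring R]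

/-- The tensor product `⨂ i, M i` of a finite family of rectangular matrices. It extends `tensor`
to encodings and to gates on sites of any dimension, for instance on pairs of qubits. -/
def tensorPi (M : ι → Matrix S T R) : Matrix (ι → S) (ι → T) R :=
  Matrix.of fun x y => ∏ i, M i (x i) (y i)

theorem tensorPi_mul [DecidableEq ι] [Fintype T] (M : ι → Matrix S T R) (N : ι → Matrix T T' R) :
    tensorPi M * tensorPi N = tensorPi fun i => M i * N i := by
  ext x y
  simp only [tensorPi, mul_apply, of_apply, ← Finset.prod_mul_distrib]
  rw [Finset.prod_univ_sum, Fintype.piFinset_univ]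

theorem tensorPi_one [DecidableEq S] :
    tensorPi (fun _ : ι => (1 : Matrix S S R)) = 1 := by
  ext x y
  simp only [tensorPi, of_apply, one_apply, Fintype.prod_ite_zero, Finset.prod_const_one,
    funext_iff]

theorem tensorPi_smul (r : ι → R) (M : ι → Matrix S T R) :
    tensorPi (fun i => r i • M i) = (∏ i, r i) • tensorPi M := by
  ext x y
  simp only [tensorPi, of_apply, Matrix.smul_apply, smul_eq_mul, Finset.prod_mul_distrib]

/-- States of the sites `ι`, grouped into the blocks of a partition `e` of `ι`. -/
def regroup (e : β × κ ≃ ι) : (ι → S) ≃ (β → κ → S) :=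
  (e.arrowCongr (Equiv.refl S)).symm.trans (Equiv.curry β κ S)

theorem tensorPi_eq_submatrix_regroup (e : β × κ ≃ ι) (M : ι → Matrix S T R) :
    tensorPi M =
      (tensorPi fun b => tensorPi fun j => M (e (b, j))).submatrix (regroup e) (regroup e) := by
  ext x y
  exact (e.prod_comp fun i => M i (x i) (y i)).symm.trans (Fintype.prod_prod_type _)

theorem realizes_tensorPi [Fintype S] [Fintype T] [DecidableEq ι] {E : ι → Matrix S T ℂ}
    {V : ι → Matrix S S ℂ} {U : ι → Matrix T T ℂ} (h : ∀ i, Realizes (E i) (V i) (U i)) :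
    Realizes (tensorPi E) (tensorPi V) (tensorPi U) := by
  choose φ hφ h using h
  refine ⟨∏ i, φ i, by simp only [norm_prod, hφ, Finset.prod_const_one], ?_⟩
  rw [tensorPi_mul, tensorPi_mul, ← tensorPi_smul]
  exact congrArg _ (funext h)

theorem exists_unitary_of_realizes [Fintype S] [DecidableEq S] [DecidableEq ι] [Nonempty ι]
    [Fintype T] {E : Matrix (ι → S) T ℂ} {V : ι → Matrix S S ℂ} {U : Matrix T T ℂ}
    (hV : ∀ i, V i ∈ unitaryGroup S ℂ) (h : Realizes E (tensorPi V) U) :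
    ∃ G : ι → Matrix S S ℂ, (∀ i, G i ∈ unitaryGroup S ℂ) ∧ tensorPi G * E = E * U := by
  obtain ⟨φ, hφ, h⟩ := h
  obtain ⟨i₀⟩ := ‹Nonempty ι›
  have hφ0 : φ ≠ 0 := ne_zero_of_norm_ne_zero (hφ.trans_ne one_ne_zero)
  refine ⟨fun i => (Pi.mulSingle i₀ φ⁻¹ : ι → ℂ) i • V i, fun i => ?_, ?_⟩
  · refine Unitary.smul_mem_of_mem ?_ (hV i)
    rw [Pi.mulSingle_apply]
    split_ifs
    · have hinv : ‖φ⁻¹‖ = 1 := by rw [norm_inv, hφ, inv_one]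
      exact Unitary.mem_iff.mpr
        ⟨by rw [Complex.star_def, Complex.conj_mul', hinv]; norm_num,
          by rw [Complex.star_def, Complex.mul_conj', hinv]; norm_num⟩
    · exact one_mem _
  · rw [tensorPi_smul, Finset.prod_pi_mulSingle', if_pos (Finset.mem_univ _), Matrix.smul_mul, h,
      smul_smul, inv_mul_cancel₀ hφ0, one_smul]

end TensorPi

section Concatenation

variable {L : ℕ} {n k : Fin L → ℕ}

/-- The qubits at level `c`, sorted by the blocks of code `c`. -/
def innerEquiv (n k : Fin L → ℕ) (c : Fin L) : Block n k c × Fin (n c) ≃ Idx n k c.val where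
  toFun p := p.1.inner p.2
  invFun q := (fun c' => q c', Fin.cast (by simp [size]) (q c))
  left_inv := by
    rintro ⟨b, i⟩
    refine Prod.ext (funext fun c' => ?_) ?_
    · simp [Block.inner, c'.2]
    · simp [Block.inner]
  right_inv q := by
    funext c'
    by_cases h : c' = c
    · subst h; simp [Block.inner]
    · simp [Block.inner, h]

theorem size_succ_of_ne {c c' : Fin L} (h : c' ≠ c) :
    size n k (c.val + 1) c' = size n k c.val c' := by
  have h1 : c'.val ≠ c.val := fun e => h (Fin.ext e)
  have h2 : c'.val < c.val + 1 ↔ c'.val < c.val := by omega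
  simp only [size, h2]

/-- The qubits at level `c + 1`, sorted by the blocks of code `c`. -/
def outerEquiv (n k : Fin L → ℕ) (c : Fin L) :
    Block n k c × Fin (k c) ≃ Idx n k (c.val + 1) where
  toFun p := p.1.outer p.2
  invFun q := (fun c' => Fin.cast (size_succ_of_ne c'.2) (q c'), Fin.cast (by simp [size]) (q c))
  left_inv := by
    rintro ⟨b, i⟩
    refine Prod.ext (funext fun c' => ?_) ?_
    · simp [Block.outer, c'.2]
    · simp [Block.outer]
  right_inv q := by
    funext c'
    by_cases h : c' = c
    · subst h; simp [Block.outer]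
    · simp [Block.outer, h]

theorem nonempty_idx_of_le (hkn : ∀ c, k c ≤ n c) {t l : ℕ} (h : t ≤ l)
    [hl : Nonempty (Idx n k l)] : Nonempty (Idx n k t) :=
  hl.map fun q c => Fin.castLE (by have := hkn c; simp only [size]; split_ifs <;> omega) (q c)

variable {S : Type} (E : ∀ c, Matrix (Fin (n c) → S) (Fin (k c) → S) ℂ)

/-- The encoding `E c` applied to every block of code `c`: `stepEncoder` for arbitrary encodings
and arbitrary sites in place of qubits. -/
def stepMap (c : Fin L) : Matrix (Idx n k c.val → S) (Idx n k (c.val + 1) → S) ℂ :=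
  Matrix.of fun x y => ∏ b : Block n k c, E c (fun i => x (b.inner i)) fun j => y (b.outer j)

theorem stepMap_eq_submatrix (c : Fin L) :
    stepMap E c = (tensorPi fun _ : Block n k c => E c).submatrix
      (regroup (innerEquiv n k c)) (regroup (outerEquiv n k c)) := rfl

variable [Fintype S] [DecidableEq S]

/-- The composition of the encodings of the codes `t, …, l - 1`: `levelEncoder` for arbitrary
encodings and arbitrary sites in place of qubits. -/
def levelMap {t l : ℕ} (h : t ≤ l) : Matrix (Idx n k t → S) (Idx n k l → S) ℂ :=
  Nat.leRecOn (C := fun l => Matrix (Idx n k t → S) (Idx n k l → S) ℂ) h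
    (fun {l} F => if hl : l < L then F * stepMap E ⟨l, hl⟩ else 0) 1

theorem levelMap_self (t : ℕ) : levelMap E (le_refl t) = 1 :=
  Nat.leRecOn_self _

theorem levelMap_succ {t l : ℕ} (h : t ≤ l) (hl : l < L) :
    levelMap E (h.trans l.le_succ) = levelMap E h * stepMap E ⟨l, hl⟩ :=
  (Nat.leRecOn_succ h _).trans (dif_pos hl)

theorem levelEncoder_eq_levelMap {Q : ∀ c, SelfDualCSS (n c) (k c)}
    (B : ∀ c, SymplecticBasis (Q c)) {t l : ℕ} (h : t ≤ l) :
    levelEncoder B h = levelMap (fun c => (B c).encoder) h := rfl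

end Concatenation

section GatesOn

variable {S : Type} [DecidableEq S] {L : ℕ} {n k : Fin L → ℕ}

open Classical in
/-- The set of gates allowed on a qubit with label `v` when the gates from `𝒮` are to be applied to
the labels in the product of the sets `A c`. Only the indices outside of `[t, l)` are tested: these
are the ones on which the encodings of the codes `t, …, l - 1` do not act. -/
def gatesOn (t l : ℕ) (A : ∀ c, Set (Fin (size n k l c))) (𝒮 : Set (Matrix S S ℂ))
    (v : Fin L → ℕ) : Set (Matrix S S ℂ) :=
  if ∀ c : Fin L, ¬ (t ≤ c.val ∧ c.val < l) → ∃ a ∈ A c, a.val = v c then 𝒮 else {1}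

theorem dependsOn_gatesOn (t l : ℕ) (A : ∀ c, Set (Fin (size n k l c)))
    (𝒮 : Set (Matrix S S ℂ)) :
    DependsOn (gatesOn t l A 𝒮) {c | ¬ (t ≤ c.val ∧ c.val < l)} := by
  intro v w hvw
  unfold gatesOn
  congr 1
  exact propext (forall₂_congr fun c hc => by rw [hvw c hc])

open Classical in
theorem ite_mem_gatesOn {t l : ℕ} {A : ∀ c, Set (Fin (size n k l c))}
    (hA : ∀ c, t ≤ c.val → c.val < l → A c = Set.univ) {𝒮 : Set (Matrix S S ℂ)}
    {g : Matrix S S ℂ} (hg : g ∈ 𝒮) (q : Idx n k l) :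
    (if ∀ c, q c ∈ A c then g else 1) ∈ gatesOn t l A 𝒮 fun c => q c := by
  have hiff : (∀ c : Fin L, ¬ (t ≤ c.val ∧ c.val < l) → ∃ a ∈ A c, a.val = q c) ↔
      ∀ c, q c ∈ A c := by
    simp only [Fin.val_inj, exists_eq_right]
    refine forall_congr' fun c => ⟨fun h => ?_, fun h _ => h⟩
    by_cases hc : t ≤ c.val ∧ c.val < l
    · exact hA c hc.1 hc.2 ▸ Set.mem_univ _
    · exact h hc
  simp only [gatesOn, hiff]
  split_ifs
  · exact hg
  · rfl

end GatesOn

section Lifting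

variable {S : Type} [Fintype S] {L : ℕ} {n k : Fin L → ℕ}
  {E : ∀ c, Matrix (Fin (n c) → S) (Fin (k c) → S) ℂ}

/-- Every product of gates from `𝒮` is implemented, through the encoding `E`, by a product of gates
from `𝒮`. -/
def LiftsProducts {ι κ : Type} [Fintype ι] [DecidableEq ι] [Fintype κ] [DecidableEq κ]
    (E : Matrix (ι → S) (κ → S) ℂ) (𝒮 : Set (Matrix S S ℂ)) : Prop :=
  ∀ U : κ → Matrix S S ℂ, (∀ j, U j ∈ 𝒮) →
    ∃ V : ι → Matrix S S ℂ, (∀ i, V i ∈ 𝒮) ∧ Realizes E (tensorPi V) (tensorPi U)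

theorem exists_realizes_stepMap (c : Fin L) {𝒯 : (Fin L → ℕ) → Set (Matrix S S ℂ)}
    (h𝒯 : DependsOn 𝒯 {c}ᶜ) (hlift : ∀ v, LiftsProducts (E c) (𝒯 v))
    {U : Idx n k (c.val + 1) → Matrix S S ℂ} (hU : ∀ q, U q ∈ 𝒯 fun c' => q c') :
    ∃ V : Idx n k c.val → Matrix S S ℂ, (∀ q, V q ∈ 𝒯 fun c' => q c') ∧
      Realizes (stepMap E c) (tensorPi V) (tensorPi U) := by
  let label (b : Block n k c) (c' : Fin L) : ℕ := if h : c' = c then 0 else b ⟨c', h⟩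
  have houter (b : Block n k c) (j : Fin (k c)) :
      (𝒯 fun c' => b.outer j c') = 𝒯 (label b) := by
    refine h𝒯 fun c' (hc' : c' ≠ c) => ?_
    simp only [label, Block.outer, dif_neg hc', Fin.val_cast]
  have hinner (b : Block n k c) (i : Fin (n c)) :
      (𝒯 fun c' => b.inner i c') = 𝒯 (label b) := by
    refine h𝒯 fun c' (hc' : c' ≠ c) => ?_
    simp only [label, Block.inner, dif_neg hc']
  choose V hV hVU using fun b : Block n k c =>
    hlift (label b) (fun j => U (b.outer j)) fun j => houter b j ▸ hU (b.outer j)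
  refine ⟨fun q => Function.uncurry V ((innerEquiv n k c).symm q), fun q => ?_, ?_⟩
  · obtain ⟨⟨b, i⟩, rfl⟩ := (innerEquiv n k c).surjective q
    simp only [Equiv.symm_apply_apply]
    exact (hinner b i).symm ▸ hV b i
  · rw [stepMap_eq_submatrix, tensorPi_eq_submatrix_regroup (innerEquiv n k c),
      tensorPi_eq_submatrix_regroup (outerEquiv n k c) U]
    refine (realizes_tensorPi fun b => ?_).submatrix _ _
    simp only [Equiv.symm_apply_apply]
    exact hVU b

variable [DecidableEq S]

theorem liftsProducts_singleton_one {ι κ : Type} [Fintype ι] [DecidableEq ι] [Fintype κ]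
    [DecidableEq κ] (E : Matrix (ι → S) (κ → S) ℂ) : LiftsProducts E {1} := by
  intro U hU
  obtain rfl : U = fun _ => 1 := funext hU
  exact ⟨fun _ => 1, fun _ => rfl, by rw [tensorPi_one, tensorPi_one]; exact Realizes.one E⟩

theorem liftsProducts_gatesOn {ι κ : Type} [Fintype ι] [DecidableEq ι] [Fintype κ] [DecidableEq κ]
    {E : Matrix (ι → S) (κ → S) ℂ} {𝒮 : Set (Matrix S S ℂ)} (h𝒮 : LiftsProducts E 𝒮) (t l : ℕ)
    (A : ∀ c, Set (Fin (size n k l c))) (v : Fin L → ℕ) : LiftsProducts E (gatesOn t l A 𝒮 v) := by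
  unfold gatesOn
  split_ifs
  · exact h𝒮
  · exact liftsProducts_singleton_one E

theorem gatesOn_subset_unitaryGroup {𝒮 : Set (Matrix S S ℂ)} (h𝒮 : 𝒮 ⊆ unitaryGroup S ℂ)
    (t l : ℕ) (A : ∀ c, Set (Fin (size n k l c))) (v : Fin L → ℕ) :
    gatesOn t l A 𝒮 v ⊆ unitaryGroup S ℂ := by
  unfold gatesOn
  split_ifs
  · exact h𝒮
  · exact Set.singleton_subset_iff.mpr (one_mem _)

theorem exists_realizes_levelMap {t l : ℕ} (h : t ≤ l) (hl : l ≤ L)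
    {𝒯 : (Fin L → ℕ) → Set (Matrix S S ℂ)}
    (h𝒯 : DependsOn 𝒯 {c | ¬ (t ≤ c.val ∧ c.val < l)}) (hlift : ∀ c v, LiftsProducts (E c) (𝒯 v))
    {U : Idx n k l → Matrix S S ℂ} (hU : ∀ q, U q ∈ 𝒯 fun c => q c) :
    ∃ V : Idx n k t → Matrix S S ℂ, (∀ q, V q ∈ 𝒯 fun c => q c) ∧
      Realizes (levelMap E h) (tensorPi V) (tensorPi U) := by
  induction l, h using Nat.le_induction with
  | base => exact ⟨U, hU, Realizes.of_eq (by rw [levelMap_self, Matrix.one_mul, Matrix.mul_one])⟩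
  | succ l h ih =>
    have hstep : DependsOn 𝒯 {⟨l, hl⟩}ᶜ :=
      h𝒯.mono (by rintro _ hc rfl; exact hc ⟨h, l.lt_succ_self⟩)
    have hrec : DependsOn 𝒯 {c : Fin L | ¬ (t ≤ c.val ∧ c.val < l)} :=
      h𝒯.mono fun c => mt fun hc => ⟨hc.1, hc.2.trans l.lt_succ_self⟩
    obtain ⟨V, hV, hVU⟩ := exists_realizes_stepMap ⟨l, hl⟩ hstep (hlift _) hU
    obtain ⟨W, hW, hWV⟩ := ih (Nat.le_of_succ_le hl) hrec hV
    exact ⟨W, hW, levelMap_succ E h hl ▸ hWV.comp hVU⟩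

open Classical in
theorem exists_unitary_mul_levelMap (hkn : ∀ c, k c ≤ n c) {t l : ℕ} (h : t ≤ l) (hl : l ≤ L)
    {A : ∀ c, Set (Fin (size n k l c))} (hA : ∀ c, t ≤ c.val → c.val < l → A c = Set.univ)
    {𝒮 : Set (Matrix S S ℂ)} (h𝒮 : 𝒮 ⊆ unitaryGroup S ℂ) (hlift : ∀ c, LiftsProducts (E c) 𝒮)
    {U : Idx n k l → Matrix S S ℂ} (hU : ∀ q, U q ∈ 𝒮) :
    ∃ G : Idx n k t → Matrix S S ℂ, (∀ q, G q ∈ unitaryGroup S ℂ) ∧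
      tensorPi G * levelMap E h =
        levelMap E h * tensorPi fun q => if ∀ c, q c ∈ A c then U q else 1 := by
  rcases isEmpty_or_nonempty (Idx n k l) with hempty | hne
  · refine ⟨1, fun _ => one_mem _, ?_⟩
    rw [Pi.one_def, tensorPi_one, Matrix.one_mul,
      Subsingleton.elim (fun q => if ∀ c, q c ∈ A c then U q else 1) fun _ => 1, tensorPi_one,
      Matrix.mul_one]
  · have := nonempty_idx_of_le hkn h
    obtain ⟨V, hV, hVU⟩ := exists_realizes_levelMap h hl (dependsOn_gatesOn t l A 𝒮)
      (fun c => liftsProducts_gatesOn (hlift c) t l A) fun q => ite_mem_gatesOn hA (hU q) q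
    exact exists_unitary_of_realizes (fun q => gatesOn_subset_unitaryGroup h𝒮 t l A _ (hV q)) hVU

end Lifting

section TwoCopies

/-- States of two registers labelled by `ι`, viewed as states of a single register of pairs. -/
def zipEquiv (ι S : Type) : (ι → S × S) ≃ (ι → S) × (ι → S) :=
  Equiv.arrowProdEquivProdArrow ι (fun _ => S) fun _ => S

variable {ι κ S : Type}

/-- Two copies of the encoding `E`, as an encoding of a single register of pairs. It reduces gates
on two blocks to gates on one block with larger sites. -/
def twoCopies (E : Matrix (ι → S) (κ → S) ℂ) : Matrix (ι → S × S) (κ → S × S) ℂ :=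
  (E ⊗ₖ E).submatrix (zipEquiv ι S) (zipEquiv κ S)

theorem twoCopies_one [Fintype ι] [DecidableEq S] :
    twoCopies (1 : Matrix (ι → S) (ι → S) ℂ) = 1 := by
  rw [twoCopies, one_kronecker_one, submatrix_one_equiv]

theorem twoCopies_mul {ρ : Type} [Fintype κ] [DecidableEq κ] [Fintype S]
    (E : Matrix (ι → S) (κ → S) ℂ) (F : Matrix (κ → S) (ρ → S) ℂ) :
    twoCopies (E * F) = twoCopies E * twoCopies F := by
  rw [twoCopies, twoCopies, twoCopies, submatrix_mul_equiv, mul_kronecker_mul]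

variable {L : ℕ} {n k : Fin L → ℕ} (E : ∀ c, Matrix (Fin (n c) → S) (Fin (k c) → S) ℂ)

theorem twoCopies_stepMap (c : Fin L) :
    twoCopies (stepMap E c) = stepMap (fun c => twoCopies (E c)) c := by
  ext x y
  exact Finset.prod_mul_distrib.symm

theorem twoCopies_levelMap [Fintype S] [DecidableEq S] {t l : ℕ} (h : t ≤ l) (hl : l ≤ L) :
    twoCopies (levelMap E h) = levelMap (fun c => twoCopies (E c)) h := by
  induction l, h using Nat.le_induction with
  | base => rw [levelMap_self, levelMap_self, twoCopies_one]
  | succ l h ih =>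
    rw [levelMap_succ E h hl, levelMap_succ _ h hl, twoCopies_mul, ih (Nat.le_of_succ_le hl),
      twoCopies_stepMap]

end TwoCopies

section TwoRegisters

variable {ι κ : Type} [Fintype ι] [Fintype κ]

theorem tensorPi_eq_submatrix_tensor₂ (F : ι → Matrix (Fin 2 × Fin 2) (Fin 2 × Fin 2) ℂ) :
    tensorPi F = (tensor₂ F).submatrix (zipEquiv ι (Fin 2)) (zipEquiv ι (Fin 2)) := rfl

theorem tensor₂_mul_kronecker_iff [DecidableEq ι] [DecidableEq κ]
    {E : Matrix (ι → Fin 2) (κ → Fin 2) ℂ}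
    {F : ι → Matrix (Fin 2 × Fin 2) (Fin 2 × Fin 2) ℂ}
    {V : κ → Matrix (Fin 2 × Fin 2) (Fin 2 × Fin 2) ℂ} :
    tensor₂ F * (E ⊗ₖ E) = (E ⊗ₖ E) * tensor₂ V ↔
      tensorPi F * twoCopies E = twoCopies E * tensorPi V := by
  rw [tensorPi_eq_submatrix_tensor₂, tensorPi_eq_submatrix_tensor₂, twoCopies,
    submatrix_mul_equiv, submatrix_mul_equiv]
  exact ((Matrix.reindex (zipEquiv ι (Fin 2)).symm (zipEquiv κ (Fin 2)).symm).injective.eq_iff).symm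

theorem tensor₂_mul [DecidableEq ι] (F F' : ι → Matrix (Fin 2 × Fin 2) (Fin 2 × Fin 2) ℂ) :
    tensor₂ F * tensor₂ F' = tensor₂ fun i => F i * F' i := by
  have h := tensorPi_mul F F'
  simp only [tensorPi_eq_submatrix_tensor₂, submatrix_mul_equiv] at h
  exact (Matrix.reindex (zipEquiv ι (Fin 2)).symm (zipEquiv ι (Fin 2)).symm).injective h

theorem tensor₂_kronecker (G G' : ι → Matrix (Fin 2) (Fin 2) ℂ) :
    tensor₂ (fun i => G i ⊗ₖ G' i) = tensor G ⊗ₖ tensor G' := by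
  ext x y
  exact Finset.prod_mul_distrib

theorem tensor₂_cnot_apply (x y a b : ι → Fin 2) :
    tensor₂ (fun _ : ι => cnot) (x, y) (a, b) = if x = a ∧ y = a + b then 1 else 0 := by
  simp only [tensor₂, of_apply, cnot, Prod.mk.injEq, Fintype.prod_ite_zero, Finset.prod_const_one,
    funext_iff, forall_and, Pi.add_apply]

theorem tensor₂_cnot_mul_apply [DecidableEq ι] {ρ : Type*}
    (M : Matrix ((ι → Fin 2) × (ι → Fin 2)) ρ ℂ) (x y : ι → Fin 2) (c : ρ) :
    (tensor₂ (fun _ : ι => cnot) * M) (x, y) c = M (x, x + y) c := by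
  have hiff (a b : ι → Fin 2) : x = a ∧ y = a + b ↔ (x, x + y) = (a, b) := by
    have h (u v w : Fin 2) : u = v + w ↔ v + u = w := by revert u v w; decide
    rw [Prod.mk.injEq]
    refine and_congr_right ?_
    rintro rfl
    exact funext_iff.trans ((forall_congr' fun i => h _ _ _).trans funext_iff.symm)
  simp only [mul_apply, Fintype.sum_prod_type, tensor₂_cnot_apply, hiff, ite_mul, one_mul, zero_mul,
    ← Fintype.sum_prod_type', Prod.mk.eta, Finset.sum_ite_eq, Finset.mem_univ, if_true]

theorem mul_tensor₂_cnot_apply [DecidableEq ι] {ρ : Type*}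
    (M : Matrix ρ ((ι → Fin 2) × (ι → Fin 2)) ℂ) (c : ρ) (a b : ι → Fin 2) :
    (M * tensor₂ (fun _ : ι => cnot)) c (a, b) = M c (a, a + b) := by
  simp only [mul_apply, Fintype.sum_prod_type, tensor₂_cnot_apply, ← Prod.mk.injEq, mul_ite,
    mul_one, mul_zero, ← Fintype.sum_prod_type', Prod.mk.eta, Finset.sum_ite_eq',
    Finset.mem_univ, if_true]

end TwoRegisters

theorem zmod_two_pi_induction {ι : Type} [Finite ι] [DecidableEq ι] {p : (ι → ZMod 2) → Prop}
    (zero : p 0) (add : ∀ a b, p a → p b → p (a + b)) (single : ∀ j, p (Pi.single j 1)) (a) :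
    p a := by
  have := Fintype.ofFinite ι
  rw [← Finset.univ_sum_single a]
  refine Finset.sum_induction _ p add zero fun i _ => ?_
  rcases zmod_two_cases (a i) with h | h <;> rw [h]
  · rwa [Pi.single_zero]
  · exact single i

theorem sgn_zero : sgn 0 = 1 :=
  if_neg zero_ne_one

theorem sgn_mul_self (a : ZMod 2) : sgn a * sgn a = 1 := by
  rw [← sgn_add, CharTwo.add_self_eq_zero, sgn_zero]

theorem norm_sgn (a : ZMod 2) : ‖sgn a‖ = 1 := by
  rw [sgn]; split_ifs <;> simp

theorem sgn_injective : Function.Injective sgn := by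
  intro a b h
  rcases zmod_two_cases a with rfl | rfl <;> rcases zmod_two_cases b with rfl | rfl
  · rfl
  · norm_num [sgn] at h
  · norm_num [sgn] at h
  · rfl

theorem pauliZ_eq_diagonal {ι : Type} [Fintype ι] (z : ι → ZMod 2) :
    pauliZ z = Matrix.diagonal fun y => sgn (z ⬝ᵥ bits y) := by
  classical
  induction z using zmod_two_pi_induction with
  | zero => simp only [pauliZ_zero, zero_dotProduct, sgn_zero, diagonal_one]
  | add a b ha hb => simp only [pauliZ_add, ha, hb, diagonal_mul_diagonal, add_dotProduct, sgn_add]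
  | single j => simp only [pauliZ_single_apply, single_one_dotProduct]

section Pauli

variable {ι : Type} [Fintype ι] [DecidableEq ι]

theorem pauli_mul_pauli (x z x' z' : ι → ZMod 2) :
    pauliX x * pauliZ z * (pauliX x' * pauliZ z') =
      sgn (z ⬝ᵥ x') • (pauliX (x + x') * pauliZ (z + z')) := by
  rw [pauliX_add, pauliZ_add, mul_assoc, ← mul_assoc (pauliZ z), pauliZ_mul_pauliX,
    Matrix.smul_mul, Matrix.mul_smul]
  simp only [mul_assoc]

theorem pauli_mul_pauli_comm (x z x' z' : ι → ZMod 2) :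
    pauliX x * pauliZ z * (pauliX x' * pauliZ z') =
      sgn (z ⬝ᵥ x' + z' ⬝ᵥ x) • (pauliX x' * pauliZ z' * (pauliX x * pauliZ z)) := by
  rw [pauli_mul_pauli, pauli_mul_pauli, smul_smul, sgn_add, mul_assoc, sgn_mul_self, mul_one,
    add_comm x, add_comm z]

theorem isUnit_pauli (x z : ι → ZMod 2) : IsUnit (pauliX x * pauliZ z) :=
  (IsUnit.of_mul_eq_one _ (pauliX_mul_self x)).mul (IsUnit.of_mul_eq_one _ (pauliZ_mul_self z))

theorem isPauli_pauliX_mul_pauliZ (x z : ι → ZMod 2) : IsPauli (pauliX x * pauliZ z) :=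
  ⟨0, x, z, by rw [pow_zero, one_smul]⟩

theorem mul_pauliX_apply {ρ : Type*} (M : Matrix ρ (ι → Fin 2) ℂ) (x : ι → ZMod 2) (c : ρ)
    (y : ι → Fin 2) : (M * pauliX x) c y = M c (bits.symm (bits y + x)) := by
  simp only [mul_apply, pauliX_apply, ← Equiv.eq_symm_apply, mul_ite, mul_one, mul_zero,
    Finset.sum_ite_eq', Finset.mem_univ, if_true]

theorem pauliX_mul_apply {ρ : Type*} (x : ι → ZMod 2) (M : Matrix (ι → Fin 2) ρ ℂ)
    (y : ι → Fin 2) (c : ρ) : (pauliX x * M) y c = M (bits.symm (bits y + x)) c := by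
  have h (b : ι → Fin 2) : bits y = bits b + x ↔ bits.symm (bits y + x) = b := by
    rw [Equiv.symm_apply_eq]
    constructor <;> intro h
    · rw [h, add_assoc, ZModModule.add_self, add_zero]
    · rw [← h, add_assoc, ZModModule.add_self, add_zero]
  simp only [mul_apply, pauliX_apply, h, ite_mul, one_mul, zero_mul, Finset.sum_ite_eq,
    Finset.mem_univ, if_true]

theorem mul_pauliZ_kronecker_pauliX_apply {ρ : Type*}
    (M : Matrix ρ ((ι → Fin 2) × (ι → Fin 2)) ℂ) (z x : ι → ZMod 2) (c : ρ) (a b : ι → Fin 2) :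
    (M * (pauliZ z ⊗ₖ pauliX x)) c (a, b) =
      M c (a, bits.symm (bits b + x)) * sgn (z ⬝ᵥ bits a) := by
  simp only [mul_apply, Fintype.sum_prod_type, kroneckerMap_apply, pauliZ_eq_diagonal,
    diagonal_apply, pauliX_apply, ← Equiv.eq_symm_apply, mul_ite, mul_one, mul_zero,
    Finset.sum_ite_eq', Finset.mem_univ, if_true]

end Pauli

section CliffordGates

theorem hadamard_mul_self : hadamard * hadamard = 1 := by
  have h : ((Real.sqrt 2 : ℝ) : ℂ)⁻¹ * ((Real.sqrt 2 : ℝ) : ℂ)⁻¹ = 2⁻¹ := by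
    rw [← mul_inv, ← Complex.ofReal_mul, Real.mul_self_sqrt zero_le_two, Complex.ofReal_ofNat]
  rw [hadamard, smul_mul_smul_comm, h]
  ext i j; fin_cases i <;> fin_cases j <;> norm_num [Matrix.mul_apply]

theorem hadamard_mul_sigmaZ : hadamard * sigmaZ = sigmaX * hadamard := by
  ext i j; fin_cases i <;> fin_cases j <;> simp [hadamard, sigmaX, sigmaZ, Matrix.mul_apply]

theorem phasePow_mul_conjTranspose (a : ℤˣ) : phasePow a * (phasePow a)ᴴ = 1 := by
  rw [phasePow]
  split_ifs <;> ext i j <;> fin_cases i <;> fin_cases j <;> simp [phaseS, Matrix.mul_apply]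

theorem phasePow_mul_sigmaZ (a : ℤˣ) : phasePow a * sigmaZ = sigmaZ * phasePow a := by
  rw [phasePow]
  split_ifs <;> ext i j <;> fin_cases i <;> fin_cases j <;>
    simp [phaseS, sigmaZ, Matrix.mul_apply]

theorem conjTranspose_phaseS : phaseSᴴ = !![1, 0; 0, -Complex.I] := by
  ext i j; fin_cases i <;> fin_cases j <;> simp [phaseS]

theorem phasePow_mul_sigmaX (a : ℤˣ) :
    ∃ r : ℂ, ‖r‖ = 1 ∧ phasePow a * sigmaX = r • (sigmaX * sigmaZ * phasePow a) := by
  rw [phasePow]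
  split_ifs
  · refine ⟨Complex.I, Complex.norm_I, ?_⟩
    ext i j; fin_cases i <;> fin_cases j <;> simp [phaseS, sigmaX, sigmaZ, Matrix.mul_apply]
  · refine ⟨-Complex.I, by rw [norm_neg, Complex.norm_I], ?_⟩
    rw [conjTranspose_phaseS]
    ext i j; fin_cases i <;> fin_cases j <;> simp [sigmaX, sigmaZ, Matrix.mul_apply]

variable {ι : Type} [Fintype ι] [DecidableEq ι]

theorem tensor_hadamard_mul_self :
    tensor (fun _ : ι => hadamard) * tensor (fun _ : ι => hadamard) = 1 := by
  simp only [tensor_mul, hadamard_mul_self, tensor_one]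

theorem tensor_hadamard_mul_pauliZ (z : ι → ZMod 2) :
    tensor (fun _ => hadamard) * pauliZ z = pauliX z * tensor fun _ => hadamard := by
  rw [pauliX, pauliZ, tensor_mul, tensor_mul]
  congr 1; funext i
  split_ifs
  · exact hadamard_mul_sigmaZ
  · rw [Matrix.mul_one, Matrix.one_mul]

theorem tensor_phasePow_mul_conjTranspose (b : ι → ℤˣ) :
    tensor (fun i => phasePow (b i)) * tensor (fun i => (phasePow (b i))ᴴ) = 1 := by
  simp only [tensor_mul, phasePow_mul_conjTranspose, tensor_one]

theorem tensor_phasePow_mul_pauliZ (b : ι → ℤˣ) (z : ι → ZMod 2) :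
    tensor (fun i => phasePow (b i)) * pauliZ z = pauliZ z * tensor fun i => phasePow (b i) := by
  rw [pauliZ, tensor_mul, tensor_mul]
  congr 1; funext i
  split_ifs
  · exact phasePow_mul_sigmaZ _
  · rw [Matrix.mul_one, Matrix.one_mul]

theorem tensor_phasePow_mul_pauliX (b : ι → ℤˣ) (x : ι → ZMod 2) : ∃ r : ℂ, ‖r‖ = 1 ∧
    tensor (fun i => phasePow (b i)) * pauliX x =
      r • (pauliX x * pauliZ x * tensor fun i => phasePow (b i)) := by
  choose r hr h using fun i => phasePow_mul_sigmaX (b i)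
  refine ⟨∏ i, if x i = 1 then r i else 1, ?_, ?_⟩
  · rw [norm_prod]
    refine Finset.prod_eq_one fun i _ => ?_
    split_ifs
    · exact hr i
    · exact norm_one
  · rw [pauliX, pauliZ, tensor_mul, tensor_mul, tensor_mul, ← tensor_smul]
    congr 1; funext i
    split_ifs
    · exact h i
    · rw [Matrix.mul_one, Matrix.one_mul, Matrix.one_mul, one_smul]

theorem tensor_phasePow_mul_pauli (b : ι → ℤˣ) (x z : ι → ZMod 2) : ∃ r : ℂ, ‖r‖ = 1 ∧
    tensor (fun i => phasePow (b i)) * (pauliX x * pauliZ z) =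
      r • (pauliX x * pauliZ (x + z) * tensor fun i => phasePow (b i)) := by
  obtain ⟨r, hr, h⟩ := tensor_phasePow_mul_pauliX b x
  refine ⟨r, hr, ?_⟩
  rw [← mul_assoc, h, Matrix.smul_mul, mul_assoc, tensor_phasePow_mul_pauliZ, pauliZ_add]
  simp only [mul_assoc]

theorem hadamard_mem_unitaryGroup : hadamard ∈ unitaryGroup (Fin 2) ℂ := by
  have h : star hadamard = hadamard := by
    ext i j; fin_cases i <;> fin_cases j <;> simp [hadamard]
  rw [mem_unitaryGroup_iff, h, hadamard_mul_self]

theorem phasePow_mem_unitaryGroup (a : ℤˣ) : phasePow a ∈ unitaryGroup (Fin 2) ℂ := by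
  rw [mem_unitaryGroup_iff, star_eq_conjTranspose, phasePow_mul_conjTranspose]

theorem sigmaX_mem_unitaryGroup : sigmaX ∈ unitaryGroup (Fin 2) ℂ := by
  have h : star sigmaX = sigmaX := by
    ext i j; fin_cases i <;> fin_cases j <;> simp [sigmaX]
  rw [mem_unitaryGroup_iff, h, sigmaX_mul_self]

theorem sigmaZ_mem_unitaryGroup : sigmaZ ∈ unitaryGroup (Fin 2) ℂ := by
  have h : star sigmaZ = sigmaZ := by
    ext i j; fin_cases i <;> fin_cases j <;> simp [sigmaZ]
  rw [mem_unitaryGroup_iff, h, sigmaZ_mul_self]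

theorem cnot_mem_unitaryGroup : cnot ∈ unitaryGroup (Fin 2 × Fin 2) ℂ := by
  have h : star cnot = cnot := by
    ext ⟨a, b⟩ ⟨a', b'⟩
    fin_cases a <;> fin_cases b <;> fin_cases a' <;> fin_cases b' <;> simp [cnot]
  rw [mem_unitaryGroup_iff, h]
  ext ⟨a, b⟩ ⟨a', b'⟩
  fin_cases a <;> fin_cases b <;> fin_cases a' <;> fin_cases b' <;> simp [cnot, Matrix.mul_apply]

/-- The gate `CNOT · (Z ^ a ⊗ X ^ b)`. These gates, unlike CNOT alone, are preserved under lifting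
products of them through two copies of a code, whatever the signs of its logical operators. -/
def cnotPauli (a b : ZMod 2) : Matrix (Fin 2 × Fin 2) (Fin 2 × Fin 2) ℂ :=
  cnot * ((if a = 1 then sigmaZ else 1) ⊗ₖ (if b = 1 then sigmaX else 1))

theorem cnotPauli_zero_zero : cnotPauli 0 0 = cnot := by
  rw [cnotPauli, if_neg zero_ne_one, if_neg zero_ne_one, one_kronecker_one, Matrix.mul_one]

theorem cnotPauli_mem_unitaryGroup (a b : ZMod 2) :
    cnotPauli a b ∈ unitaryGroup (Fin 2 × Fin 2) ℂ := by
  refine mul_mem cnot_mem_unitaryGroup (kronecker_mem_unitary ?_ ?_)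
  · split_ifs
    · exact sigmaZ_mem_unitaryGroup
    · exact one_mem _
  · split_ifs
    · exact sigmaX_mem_unitaryGroup
    · exact one_mem _

theorem tensor₂_cnotPauli (z x : ι → ZMod 2) :
    tensor₂ (fun i => cnotPauli (z i) (x i)) =
      tensor₂ (fun _ => cnot) * (pauliZ z ⊗ₖ pauliX x) := by
  rw [pauliZ, pauliX, ← tensor₂_kronecker, tensor₂_mul]
  rfl

end CliffordGates

namespace Realizes

variable {ι κ : Type} [Fintype ι] [DecidableEq ι] [Fintype κ] [DecidableEq κ]
  {E : Matrix (ι → Fin 2) (κ → Fin 2) ℂ} {x x' z z' : ι → ZMod 2} {a a' b b' : κ → ZMod 2}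

theorem pauli_add (h : Realizes E (pauliX x * pauliZ z) (pauliX a * pauliZ b))
    (h' : Realizes E (pauliX x' * pauliZ z') (pauliX a' * pauliZ b')) :
    Realizes E (pauliX (x + x') * pauliZ (z + z')) (pauliX (a + a') * pauliZ (b + b')) := by
  have hmul := h.mul h'
  rwa [pauli_mul_pauli, pauli_mul_pauli, smul_left_iff (norm_sgn _),
    smul_right_iff (norm_sgn _)] at hmul

theorem symplectic_eq (hE : E ≠ 0) (h : Realizes E (pauliX x * pauliZ z) (pauliX a * pauliZ b))
    (h' : Realizes E (pauliX x' * pauliZ z') (pauliX a' * pauliZ b')) :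
    z ⬝ᵥ x' + z' ⬝ᵥ x = b ⬝ᵥ a' + b' ⬝ᵥ a :=
  sgn_injective <| h.commutator_eq hE h' (isUnit_pauli a b) (isUnit_pauli a' b')
    (pauli_mul_pauli_comm x z x' z') (pauli_mul_pauli_comm a b a' b')

theorem conj_hadamard
    (hH : Realizes E (tensor fun _ => hadamard) (tensor fun _ => hadamard))
    (h : Realizes E (pauliZ z) (pauliZ b)) : Realizes E (pauliX z) (pauliX b) := by
  have hmul := hH.mul h
  rw [tensor_hadamard_mul_pauliZ, tensor_hadamard_mul_pauliZ] at hmul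
  exact hmul.of_mul_right hH tensor_hadamard_mul_self

theorem conj_phasePow {s : ι → ℤˣ} {t : κ → ℤˣ}
    (hS : Realizes E (tensor fun i => phasePow (s i)) (tensor fun j => phasePow (t j)))
    (h : Realizes E (pauliX x * pauliZ z) (pauliX a * pauliZ b)) :
    Realizes E (pauliX x * pauliZ (x + z)) (pauliX a * pauliZ (a + b)) := by
  obtain ⟨r, hr, hphys⟩ := tensor_phasePow_mul_pauli s x z
  obtain ⟨r', hr', hlog⟩ := tensor_phasePow_mul_pauli t a b
  have hmul := hS.mul h
  rw [hphys, hlog, smul_left_iff hr, smul_right_iff hr'] at hmul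
  exact hmul.of_mul_right hS (tensor_phasePow_mul_conjTranspose t)

theorem exists_forall_mul_eq_sgn_smul {P : (ι → ZMod 2) → Op ι} {R : (κ → ZMod 2) → Op κ}
    (hP0 : P 0 = 1) (hP : ∀ x y, P (x + y) = P x * P y) (hR0 : R 0 = 1)
    (hR : ∀ a b, R (a + b) = R a * R b) (hE : E ≠ 0) {U : Matrix κ ι (ZMod 2)}
    (h : ∀ j, Realizes E (P (U j)) (R (Pi.single j 1))) :
    ∃ e : κ → ZMod 2, ∀ p, P (p ᵥ* U) * E = sgn (e ⬝ᵥ p) • (E * R p) := by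
  have hPP (x) : P x * P x = 1 := by rw [← hP, ZModModule.add_self, hP0]
  have hRR (a) : R a * R a = 1 := by rw [← hR, ZModModule.add_self, hR0]
  choose e he using fun j => (h j).exists_mul_eq_sgn_smul hE (hPP _) (hRR _)
  refine ⟨e, fun p => ?_⟩
  induction p using zmod_two_pi_induction with
  | zero =>
    rw [zero_vecMul, hP0, hR0, dotProduct_zero, sgn_zero, one_smul, Matrix.one_mul, Matrix.mul_one]
  | add a b ha hb =>
    rw [add_vecMul, hP, hR, Matrix.mul_assoc, hb, Matrix.mul_smul, ← Matrix.mul_assoc, ha,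
      Matrix.smul_mul, smul_smul, Matrix.mul_assoc, dotProduct_add, sgn_add, mul_comm]
  | single j => rw [single_one_vecMul, dotProduct_single_one]; exact he j

end Realizes

section SingleCode

variable {n k : ℕ} {Q : SelfDualCSS n k}

namespace SelfDualCSS

theorem mem_checks_of_dual {x : Fin n → ZMod 2}
    (h : ∀ y, (∀ g ∈ Q.checks, g ⬝ᵥ y = 0) → x ⬝ᵥ y = 0) : x ∈ Q.checks := by
  by_contra hx
  obtain ⟨f, hf, hker⟩ := Submodule.exists_le_ker_of_notMem hx
  have hdot (v : Fin n → ZMod 2) : f v = v ⬝ᵥ fun i => f (Pi.single i 1) := by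
    simp only [LinearMap.pi_apply_eq_sum_univ f v, dotProduct, smul_eq_mul, ← Pi.single_apply,
      Pi.single_comm]
  exact hf ((hdot x).trans (h _ fun g hg => (hdot g).symm.trans (hker hg)))

theorem commute_pauli {x z : Fin n → ZMod 2} (hx : ∀ g ∈ Q.checks, g ⬝ᵥ x = 0)
    (hz : ∀ g ∈ Q.checks, g ⬝ᵥ z = 0) : ∀ s ∈ Q.stabilizers, Commute (pauliX x * pauliZ z) s := by
  rintro s ⟨g, hg, h, hh, rfl⟩
  rw [commute_iff_eq, pauli_mul_pauli_comm, dotProduct_comm, hz g hg, hx h hh, add_zero, sgn_zero,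
    one_smul]

theorem le (Q : SelfDualCSS n k) : k ≤ n :=
  (Nat.le_add_left k _).trans_eq Q.finrank_checks

end SelfDualCSS

namespace SymplecticBasis

variable (B : SymplecticBasis Q)

theorem encoder_ne_zero : B.encoder ≠ 0 := by
  intro h
  have hiso := B.isEncoder.isometry
  rw [h, Matrix.mul_zero] at hiso
  exact zero_ne_one hiso

theorem stabilizer_mul_encoder {s : Op (Fin n)} (hs : s ∈ Q.stabilizers) :
    s * B.encoder = B.encoder := by
  refine Matrix.ext_of_mulVec_single fun a => ?_
  have hmem : B.encoder *ᵥ Pi.single a 1 ∈ Q.codeSpace := by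
    rw [← B.isEncoder.range_eq]
    exact ⟨_, rfl⟩
  rw [← Matrix.mulVec_mulVec]
  exact hmem s hs

theorem pauliX_mul_encoder {g : Fin n → ZMod 2} (hg : g ∈ Q.checks) :
    pauliX g * B.encoder = B.encoder :=
  B.stabilizer_mul_encoder ⟨g, hg, 0, Q.checks.zero_mem, by rw [pauliZ_zero, mul_one]⟩

theorem pauliZ_mul_encoder {g : Fin n → ZMod 2} (hg : g ∈ Q.checks) :
    pauliZ g * B.encoder = B.encoder :=
  B.stabilizer_mul_encoder ⟨0, Q.checks.zero_mem, g, hg, by rw [pauliX_zero, one_mul]⟩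

theorem exists_realizes_of_commute {P : Op (Fin n)} (hP : IsPauli P)
    (hcomm : ∀ s ∈ Q.stabilizers, Commute P s) :
    ∃ a b, Realizes B.encoder P (pauliX a * pauliZ b) := by
  have hgen := B.generate P hP hcomm
  clear hP hcomm
  induction hgen using Submonoid.closure_induction with
  | mem P hmem =>
    rcases hmem with ((hs | rfl) | ⟨j, rfl⟩) | ⟨j, rfl⟩
    · refine ⟨0, 0, Realizes.of_eq ?_⟩
      rw [B.stabilizer_mul_encoder hs, pauliX_zero, pauliZ_zero, mul_one, Matrix.mul_one]
    · refine ⟨0, 0, (Realizes.smul_left_iff Complex.norm_I).mpr ?_⟩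
      rw [pauliX_zero, pauliZ_zero, mul_one]
      exact Realizes.one _
    · refine ⟨Pi.single j 1, 0, Realizes.of_eq ?_⟩
      rw [pauliZ_zero, mul_one, B.isEncoder.map_X]
    · refine ⟨0, Pi.single j 1, Realizes.of_eq ?_⟩
      rw [pauliX_zero, one_mul, B.isEncoder.map_Z]
  | one =>
    refine ⟨0, 0, ?_⟩
    rw [pauliX_zero, pauliZ_zero, mul_one]
    exact Realizes.one _
  | mul P P' _ _ h h' =>
    obtain ⟨a, b, h⟩ := h
    obtain ⟨a', b', h'⟩ := h'
    have hmul := h.mul h'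
    rw [pauli_mul_pauli, Realizes.smul_right_iff (norm_sgn _)] at hmul
    exact ⟨_, _, hmul⟩

theorem exists_realizes_of_dual {x z : Fin n → ZMod 2} (hx : ∀ g ∈ Q.checks, g ⬝ᵥ x = 0)
    (hz : ∀ g ∈ Q.checks, g ⬝ᵥ z = 0) :
    ∃ a b, Realizes B.encoder (pauliX x * pauliZ z) (pauliX a * pauliZ b) :=
  B.exists_realizes_of_commute (isPauli_pauliX_mul_pauliZ x z) (SelfDualCSS.commute_pauli hx hz)

theorem mem_checks_of_realizes_one {x z : Fin n → ZMod 2}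
    (h : Realizes B.encoder (pauliX x * pauliZ z) (pauliX 0 * pauliZ 0)) :
    x ∈ Q.checks ∧ z ∈ Q.checks := by
  have horth {x' z'} (hx' : ∀ g ∈ Q.checks, g ⬝ᵥ x' = 0) (hz' : ∀ g ∈ Q.checks, g ⬝ᵥ z' = 0) :
      z ⬝ᵥ x' + z' ⬝ᵥ x = 0 := by
    obtain ⟨a, b, h'⟩ := B.exists_realizes_of_dual hx' hz'
    rw [h.symplectic_eq B.encoder_ne_zero h', zero_dotProduct, dotProduct_zero, add_zero]
  have hzero (g) (_ : g ∈ Q.checks) : g ⬝ᵥ (0 : Fin n → ZMod 2) = 0 := dotProduct_zero g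
  constructor <;> refine SelfDualCSS.mem_checks_of_dual fun y hy => ?_
  · simpa only [dotProduct_zero, zero_add, dotProduct_comm y] using horth hzero hy
  · simpa only [zero_dotProduct, add_zero] using horth hy hzero

variable {B}

theorem IsCompatible.exists_realizes_pauliZ (hB : B.IsCompatible) (j : Fin k) :
    ∃ u, Realizes B.encoder (pauliZ u) (pauliZ (Pi.single j 1)) := by
  obtain ⟨c, x, z, hZ⟩ := B.isPauli_Z j
  have hlog : Realizes B.encoder (pauliX x * pauliZ z) (pauliX 0 * pauliZ (Pi.single j 1)) := by
    have hnorm : ‖Complex.I ^ c‖ = 1 := by rw [norm_pow, Complex.norm_I, one_pow]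
    rw [← Realizes.smul_left_iff hnorm, ← hZ, pauliX_zero, one_mul]
    exact Realizes.of_eq (B.isEncoder.map_Z j).symm
  have hx : x ∈ Q.checks := by
    -- Conjugation by phase gates multiplies this operator by `Z ^ x` but fixes the logical `Z`.
    obtain ⟨b, hS⟩ := hB.phase 1
    have hadd := (Realizes.conj_phasePow hS hlog).pauli_add hlog
    rw [zero_add, ZModModule.add_self, add_assoc, ZModModule.add_self, add_zero, zero_add,
      ZModModule.add_self] at hadd
    exact (B.mem_checks_of_realizes_one hadd).2
  refine ⟨z, ?_⟩
  have hXx : Realizes B.encoder (pauliX x * pauliZ 0) (pauliX 0 * pauliZ 0) := by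
    refine Realizes.of_eq ?_
    rw [pauliZ_zero, mul_one, B.pauliX_mul_encoder hx, pauliX_zero, pauliZ_zero, mul_one,
      Matrix.mul_one]
  have hadd := hXx.pauli_add hlog
  rwa [ZModModule.add_self, zero_add, zero_add, zero_add, pauliX_zero, pauliX_zero, one_mul,
    one_mul] at hadd

/-- A choice of logical operators of pure `X`- and `Z`-type. The logical operators `X` and `Z` of
qubit `j` are supported on the same row `support j`; they agree with those of `B` up to stabilizers
and the signs recorded by `signX j` and `signZ j`. -/
structure PureForm (B : SymplecticBasis Q) where
  support : Matrix (Fin k) (Fin n) (ZMod 2)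
  signX : Fin k → ZMod 2
  signZ : Fin k → ZMod 2
  pauliX_mul_encoder : ∀ p,
    pauliX (p ᵥ* support) * B.encoder = sgn (signX ⬝ᵥ p) • (B.encoder * pauliX p)
  pauliZ_mul_encoder : ∀ p,
    pauliZ (p ᵥ* support) * B.encoder = sgn (signZ ⬝ᵥ p) • (B.encoder * pauliZ p)

theorem IsCompatible.nonempty_pureForm (hB : B.IsCompatible) : Nonempty B.PureForm := by
  choose U hZ using hB.exists_realizes_pauliZ
  have hX (j) : Realizes B.encoder (pauliX (U j)) (pauliX (Pi.single j 1)) :=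
    Realizes.conj_hadamard hB.hadamard (hZ j)
  obtain ⟨e, he⟩ := Realizes.exists_forall_mul_eq_sgn_smul pauliZ_zero pauliZ_add pauliZ_zero
    pauliZ_add B.encoder_ne_zero hZ
  obtain ⟨f, hf⟩ := Realizes.exists_forall_mul_eq_sgn_smul pauliX_zero pauliX_add pauliX_zero
    pauliX_add B.encoder_ne_zero hX
  exact ⟨⟨U, f, e, hf, he⟩⟩

namespace PureForm

variable (F : B.PureForm)

theorem realizes_pauliX (p : Fin k → ZMod 2) :
    Realizes B.encoder (pauliX (p ᵥ* F.support)) (pauliX p) :=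
  ⟨_, norm_sgn _, F.pauliX_mul_encoder p⟩

theorem realizes_pauliZ (p : Fin k → ZMod 2) :
    Realizes B.encoder (pauliZ (p ᵥ* F.support)) (pauliZ p) :=
  ⟨_, norm_sgn _, F.pauliZ_mul_encoder p⟩

theorem realizes_pauliX_of_dual {x : Fin n → ZMod 2} (hx : ∀ g ∈ Q.checks, g ⬝ᵥ x = 0) :
    Realizes B.encoder (pauliX x) (pauliX (F.support *ᵥ x)) := by
  obtain ⟨a, b, h⟩ := B.exists_realizes_of_dual hx fun g _ => dotProduct_zero g
  have ha : a = F.support *ᵥ x := by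
    refine dotProduct_eq _ _ fun p => ?_
    have hZ : Realizes B.encoder (pauliX 0 * pauliZ (p ᵥ* F.support)) (pauliX 0 * pauliZ p) := by
      rw [pauliX_zero, pauliX_zero, one_mul, one_mul]
      exact F.realizes_pauliZ p
    have hsymp := h.symplectic_eq B.encoder_ne_zero hZ
    rw [dotProduct_zero, dotProduct_zero, zero_add, zero_add, ← dotProduct_mulVec] at hsymp
    rw [dotProduct_comm, ← hsymp, dotProduct_comm]
  have hb : b = 0 := by
    refine dotProduct_eq_zero _ fun p => ?_
    have hX : Realizes B.encoder (pauliX (p ᵥ* F.support) * pauliZ 0) (pauliX p * pauliZ 0) := by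
      rw [pauliZ_zero, pauliZ_zero, mul_one, mul_one]
      exact F.realizes_pauliX p
    have hsymp := h.symplectic_eq B.encoder_ne_zero hX
    rw [zero_dotProduct, zero_dotProduct, zero_dotProduct, add_zero, add_zero] at hsymp
    exact hsymp.symm
  rwa [ha, hb, pauliZ_zero, pauliZ_zero, mul_one, mul_one] at h

theorem pauliX_mul_encoder_of_dual {x : Fin n → ZMod 2} (hx : ∀ g ∈ Q.checks, g ⬝ᵥ x = 0) :
    pauliX x * B.encoder =
      sgn (F.signX ⬝ᵥ (F.support *ᵥ x)) • (B.encoder * pauliX (F.support *ᵥ x)) := by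
  set w := (F.support *ᵥ x) ᵥ* F.support with hw
  have hmem : w + x ∈ Q.checks := by
    have hone : Realizes B.encoder (pauliX (w + x) * pauliZ 0) (pauliX 0 * pauliZ 0) := by
      rw [pauliX_add, pauliX_zero, pauliZ_zero, pauliZ_zero, mul_one, mul_one,
        ← pauliX_mul_self (F.support *ᵥ x)]
      exact (F.realizes_pauliX _).mul (F.realizes_pauliX_of_dual hx)
    exact (B.mem_checks_of_realizes_one hone).1
  rw [← F.pauliX_mul_encoder, ← hw]
  calc pauliX x * B.encoder = pauliX w * (pauliX (w + x) * B.encoder) := by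
        rw [← Matrix.mul_assoc, ← pauliX_add, ← add_assoc, ZModModule.add_self, zero_add]
    _ = pauliX w * B.encoder := by rw [B.pauliX_mul_encoder hmem]

end PureForm

theorem dual_of_encoder_apply_ne_zero {x : Fin n → Fin 2} {a : Fin k → Fin 2}
    (h : B.encoder x a ≠ 0) : ∀ g ∈ Q.checks, g ⬝ᵥ bits x = 0 := by
  intro g hg
  have hfix := congrFun₂ (B.pauliZ_mul_encoder hg) x a
  rw [pauliZ_eq_diagonal, diagonal_mul, mul_eq_right₀ h, ← sgn_zero] at hfix
  exact sgn_injective hfix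

namespace PureForm

variable (F : B.PureForm)

theorem support_mulVec_bits {x : Fin n → Fin 2} {a : Fin k → Fin 2} (h : B.encoder x a ≠ 0) :
    F.support *ᵥ bits x = F.signZ + bits a := by
  refine dotProduct_eq _ _ fun p => sgn_injective (mul_right_cancel₀ h ?_)
  have hZ := congrFun₂ (F.pauliZ_mul_encoder p) x a
  rw [pauliZ_eq_diagonal, pauliZ_eq_diagonal, diagonal_mul, Matrix.smul_apply, mul_diagonal,
    smul_eq_mul, ← dotProduct_mulVec, dotProduct_comm, dotProduct_comm p] at hZ
  rw [hZ, add_dotProduct, sgn_add, mul_comm (B.encoder x a), mul_assoc]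

theorem encoder_add_apply {x : Fin n → Fin 2} {a : Fin k → Fin 2} (h : B.encoder x a ≠ 0)
    (y : Fin n → Fin 2) (b : Fin k → Fin 2) :
    B.encoder (x + y) b = sgn (F.signX ⬝ᵥ (F.signZ + bits a)) *
      B.encoder y (a + bits.symm (bits b + F.signZ)) := by
  have hX := congrFun₂ (F.pauliX_mul_encoder_of_dual (dual_of_encoder_apply_ne_zero h)) y b
  have hphys : bits.symm (bits y + bits x) = x + y := add_comm (bits y) (bits x)
  have hlog : bits.symm (bits b + (F.signZ + bits a)) = a + bits.symm (bits b + F.signZ) := by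
    change bits b + (F.signZ + bits a) = bits a + (bits b + F.signZ)
    abel
  rwa [pauliX_mul_apply, Matrix.smul_apply, mul_pauliX_apply, F.support_mulVec_bits h, hphys, hlog,
    smul_eq_mul] at hX

theorem realizes_cnot :
    Realizes (B.encoder ⊗ₖ B.encoder) (tensor₂ fun _ => cnot)
      (tensor₂ (fun _ => cnot) * (pauliZ F.signX ⊗ₖ pauliX F.signZ)) := by
  refine ⟨sgn (F.signX ⬝ᵥ F.signZ), norm_sgn _, ?_⟩
  ext ⟨x, y⟩ ⟨a, b⟩
  rw [tensor₂_cnot_mul_apply, Matrix.smul_apply, ← Matrix.mul_assoc,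
    mul_pauliZ_kronecker_pauliX_apply, mul_tensor₂_cnot_apply, kroneckerMap_apply,
    kroneckerMap_apply, smul_eq_mul]
  by_cases h : B.encoder x a = 0
  · rw [h, zero_mul, zero_mul, zero_mul, mul_zero]
  · rw [F.encoder_add_apply h, dotProduct_add, sgn_add]
    ring

end PureForm

namespace IsCompatible

theorem liftsProducts_hadamard (hB : B.IsCompatible) :
    LiftsProducts B.encoder {Multilevel.hadamard} := by
  intro U hU
  obtain rfl : U = fun _ => Multilevel.hadamard := funext hU
  exact ⟨fun _ => Multilevel.hadamard, fun _ => rfl, hB.hadamard⟩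

theorem liftsProducts_phasePow (hB : B.IsCompatible) :
    LiftsProducts B.encoder (Set.range phasePow) := by
  intro U hU
  choose a ha using hU
  obtain ⟨b, hb⟩ := hB.phase a
  obtain rfl := funext ha
  exact ⟨fun i => phasePow (b i), fun i => ⟨b i, rfl⟩, hb⟩

theorem liftsProducts_cnotPauli (hB : B.IsCompatible) :
    LiftsProducts (twoCopies B.encoder) (Set.range (Function.uncurry cnotPauli)) := by
  obtain ⟨F⟩ := hB.nonempty_pureForm
  intro U hU
  choose p hp using hU
  obtain rfl := funext hp
  set z := fun j => (p j).1
  set x := fun j => (p j).2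
  refine ⟨fun i => cnotPauli (((F.signX + z) ᵥ* F.support) i) (((F.signZ + x) ᵥ* F.support) i),
    fun i => ⟨(_, _), rfl⟩, ?_⟩
  have hcancel : (pauliZ F.signX ⊗ₖ pauliX F.signZ) *
      (pauliZ (F.signX + z) ⊗ₖ pauliX (F.signZ + x)) = pauliZ z ⊗ₖ pauliX x := by
    rw [← mul_kronecker_mul, ← pauliZ_add, ← pauliX_add, ← add_assoc, ← add_assoc,
      ZModModule.add_self, ZModModule.add_self, zero_add, zero_add]
  have hmul := F.realizes_cnot.mul
    ((F.realizes_pauliZ (F.signX + z)).kronecker (F.realizes_pauliX (F.signZ + x)))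
  rw [mul_assoc, hcancel, ← tensor₂_cnotPauli, ← tensor₂_cnotPauli] at hmul
  exact hmul.submatrix _ _

end IsCompatible

end SymplecticBasis

end SingleCode

section Transversality

variable {L : ℕ} {n k : Fin L → ℕ} {Q : ∀ c, SelfDualCSS (n c) (k c)}
  {B : ∀ c, SymplecticBasis (Q c)} {t l : ℕ} {A : ∀ c, Set (Fin (size n k l c))}

open Classical in
theorem isTransversalAt_of_liftsProducts (h : t ≤ l) (hl : l ≤ L)
    (hA : ∀ c, t ≤ c.val → c.val < l → A c = Set.univ) {𝒮 : Set (Matrix (Fin 2) (Fin 2) ℂ)}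
    (h𝒮 : 𝒮 ⊆ unitaryGroup (Fin 2) ℂ) (hlift : ∀ c, LiftsProducts (B c).encoder 𝒮)
    {U : Idx n k l → Matrix (Fin 2) (Fin 2) ℂ} (hU : ∀ q, U q ∈ 𝒮) :
    IsTransversalAt B h (tensor fun q => if ∀ c, q c ∈ A c then U q else 1) := by
  rw [IsTransversalAt, levelEncoder_eq_levelMap]
  exact exists_unitary_mul_levelMap (fun c => (Q c).le) h hl hA h𝒮 hlift hU

open Classical in
theorem isTransversalAt₂_of_liftsProducts (h : t ≤ l) (hl : l ≤ L)
    (hA : ∀ c, t ≤ c.val → c.val < l → A c = Set.univ)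
    {𝒮 : Set (Matrix (Fin 2 × Fin 2) (Fin 2 × Fin 2) ℂ)} (h𝒮 : 𝒮 ⊆ unitaryGroup (Fin 2 × Fin 2) ℂ)
    (hlift : ∀ c, LiftsProducts (twoCopies (B c).encoder) 𝒮)
    {V : Idx n k l → Matrix (Fin 2 × Fin 2) (Fin 2 × Fin 2) ℂ} (hV : ∀ q, V q ∈ 𝒮) :
    IsTransversalAt₂ B h (tensor₂ fun q => if ∀ c, q c ∈ A c then V q else 1) := by
  obtain ⟨G, hG, hGV⟩ := exists_unitary_mul_levelMap (fun c => (Q c).le) h hl hA h𝒮 hlift hV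
  rw [← twoCopies_levelMap _ h hl, ← levelEncoder_eq_levelMap B h] at hGV
  exact ⟨G, hG, tensor₂_mul_kronecker_iff.mpr hGV⟩

end Transversality

end

end Multilevel

open Multilevel in
theorem theorem3_general {L : ℕ} {n k : Fin L → ℕ} (Q : ∀ c, SelfDualCSS (n c) (k c))
    (B : ∀ c, SymplecticBasis (Q c)) (hB : ∀ c, (B c).IsCompatible) {t l : ℕ} (htl : t ≤ l)
    (hlL : l ≤ L) (A : ∀ c, Set (Fin (size n k l c)))
    (hA : ∀ c, t ≤ c.val → c.val < l → A c = Set.univ) :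
    IsTransversalAt B htl (gateH A) ∧
    (∀ a : Idx n k l → ℤˣ, IsTransversalAt B htl (gateS A a)) ∧
    IsTransversalAt₂ B htl (gateCNOT A) := by
  refine ⟨?_, fun a => ?_, ?_⟩
  · exact isTransversalAt_of_liftsProducts htl hlL hA
      (Set.singleton_subset_iff.mpr hadamard_mem_unitaryGroup)
      (fun c => (hB c).liftsProducts_hadamard) fun _ => Set.mem_singleton _
  · exact isTransversalAt_of_liftsProducts htl hlL hA
      (Set.range_subset_iff.mpr phasePow_mem_unitaryGroup)
      (fun c => (hB c).liftsProducts_phasePow) fun q => ⟨a q, rfl⟩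
  · have hcnot : cnot ∈ Set.range (Function.uncurry cnotPauli) := ⟨(0, 0), cnotPauli_zero_zero⟩
    have hunitary : Set.range (Function.uncurry cnotPauli) ⊆ unitaryGroup (Fin 2 × Fin 2) ℂ :=
      Set.range_subset_iff.mpr fun p => cnotPauli_mem_unitaryGroup p.1 p.2
    exact isTransversalAt₂_of_liftsProducts htl hlL hA hunitary
      (fun c => (hB c).liftsProducts_cnotPauli) fun _ => hcnot

theorem theorem3 {L : ℕ} {n k : Fin L → ℕ} (hk : ∀ c, 1 ≤ k c)
    (Q : ∀ c, Multilevel.SelfDualCSS (n c) (k c))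
    (B : ∀ c, Multilevel.SymplecticBasis (Q c)) (hB : ∀ c, (B c).IsCompatible)
    (m l : ℕ) (hml : m < l) (hlL : l ≤ L) (q : Multilevel.Idx n k l)
    (t : ℕ) (hmt : m ≤ t) (htl : t ≤ l) :
    Multilevel.IsTransversalAt B htl (Multilevel.gateH (Multilevel.indexSets m q)) ∧
    (∀ a : Multilevel.Idx n k l → ℤˣ,
      Multilevel.IsTransversalAt B htl (Multilevel.gateS (Multilevel.indexSets m q) a)) ∧
    Multilevel.IsTransversalAt₂ B htl (Multilevel.gateCNOT (Multilevel.indexSets m q)) :=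
  theorem3_general Q B hB htl hlL _ fun _ htc hcl => if_pos ⟨hmt.trans htc, hcl⟩
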